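/- Let $m>1$ be an integer and define the integers $a_n$ ($n\ge 0$) by the power series expansion $$\prod_{k=1}^{\infty}\frac{1+q^k}{1+q^{mk}}=\sum_{n=0}^{\infty}a_n q^n .$$ Then, as $n\to\infty$, $$a_n\sim\frac{(m-1)^{1/4}}{2^{3/2}\,3^{1/4}\,m^{1/4}\,n^{3/4}}\exp\left(\pi\sqrt{\frac{(m-1)n}{3m}}\right).$$ More generally, let $h\ge 1$ be an integer and define $a_n^{(h)}$ ($n\ge 0$) by $$\prod_{k=1}^{\infty}\left(\frac{1+q^k}{1+q^{mk}}\right)^{h}=\sum_{n=0}^{\infty}a_n^{(h)} q^n .$$ Then, as $n\to\infty$, $$a_n^{(h)}\sim\frac{\left(\frac{h(m-1)}{3m}\right)^{1/4}}{2^{3/2}\,n^{3/4}}\exp\left(\pi\sqrt{\frac{h(m-1)n}{3m}}\right).$$ Here $u_n\sim v_n$ means $u_n/v_n\to1$, and the infinite products converge coefficientwise as formal power series in $q$. -/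

import Mathlib

open scoped PowerSeries.WithPiTopology

/-- The factor `(1 + q ^ k) / (1 + q ^ (m * k))` as a formal power series in `q` over `ℝ`.
For `m * k ≥ 1` the denominator has constant coefficient `1`, so the inverse is genuine. -/
noncomputable def qFactor (m k : ℕ) : PowerSeries ℝ :=
  (1 + PowerSeries.X ^ k) * (1 + PowerSeries.X ^ (m * k))⁻¹

/-- The infinite product over `k ≥ 1` of `(1 + q ^ k) / (1 + q ^ (m * k))`, as a formal power
series (the limit is taken coefficientwise). -/
noncomputable def qProduct (m : ℕ) : PowerSeries ℝ :=
  ∏' k : ℕ, qFactor m (k + 1)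

/-- The infinite product over `k ≥ 1` of `((1 + q ^ k) / (1 + q ^ (m * k))) ^ h`, as a formal power
series (the limit is taken coefficientwise). -/
noncomputable def qProductPow (m h : ℕ) : PowerSeries ℝ :=
  ∏' k : ℕ, qFactor m (k + 1) ^ h

open Filter Topology MeasureTheory

/-! The proof is a saddle point analysis. Cancelling the factors of the denominator leaves the
product of `1 + q ^ k` over `k` not divisible by `m`, so with `q = exp (-z)` and `Re z > 0` the
`h`-th power is `exp (h * logSum m z)`. Cauchy's formula writes the `n`-th coefficient as an
integral of `exp (h * logSum m z + n z)` along `Re z = t`.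

Near the positive real axis `logSum m z = B / z + O(Re z)` with `B = π² (m - 1) / (12 m)`
(`norm_logSum_sub_le`). The exponent is thus close to `A / z + n z` with `A = h B`, whose saddle
point is `z = √(A / n)`. Put `t = τ ^ 2 = √(A / n)` and `θ = τ ^ 3 u`: after division by the saddle
value `exp (2 A / τ ^ 2)` the integrand tends pointwise to `exp (-A u ^ 2)`.

The remaining difficulty is a bound uniform over the whole circle. Moving away from the real axis
costs at least `cosDefect / 4` in `Re logSum` (`re_logSum_le`), and `exists_le_cosDefect` bounds
this loss below by `c / t` or by `c θ² / t³ = c u²`. Either way the integrand is dominated by a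
multiple of `1 / (1 + u²)`, and dominated convergence gives the Gaussian integral `√(π / A)`. -/

/-! ### The infinite product as a formal power series. -/

theorem PowerSeries.multipliable_of_X_pow_dvd_sub_one {u : ℕ → PowerSeries ℝ}
    (hu : ∀ k, PowerSeries.X ^ (k + 1) ∣ u k - 1) : Multipliable u := by
  have h : Multipliable (fun k => 1 + (u k - 1)) := by
    apply PowerSeries.WithPiTopology.multipliable_one_add_of_tendsto_order_atTop_nhds_top
    refine ENat.tendsto_nhds_top_iff_natCast_lt.mpr fun n => eventually_atTop.mpr ⟨n, fun k hk => ?_⟩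
    have := (PowerSeries.X_pow_dvd_iff).1 (hu k)
    refine lt_of_lt_of_le ?_ (PowerSeries.nat_le_order _ (k + 1) fun i hi => this i hi)
    exact_mod_cast Nat.lt_add_one_iff.mpr hk
  simpa using h

theorem PowerSeries.tprod_ne_zero_of_X_pow_dvd_sub_one {u : ℕ → PowerSeries ℝ}
    (hu : ∀ k, PowerSeries.X ^ (k + 1) ∣ u k - 1) : ∏' k, u k ≠ 0 := by
  intro h
  have h1 := (multipliable_of_X_pow_dvd_sub_one hu).map_tprod (PowerSeries.constantCoeff (R := ℝ))
    (PowerSeries.WithPiTopology.continuous_constantCoeff ℝ)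
  have h2 : ∀ k, PowerSeries.constantCoeff (u k) = 1 := fun k => by
    have := (PowerSeries.X_pow_dvd_iff).1 (hu k) 0 (Nat.succ_pos k)
    simpa [sub_eq_zero] using this
  rw [h] at h1
  simp [h2] at h1

theorem qFactor_sub_one_dvd {m : ℕ} (hm : 0 < m) (k : ℕ) :
    PowerSeries.X ^ (k + 1) ∣ qFactor m (k + 1) - 1 := by
  have hne : m * (k + 1) ≠ 0 := by positivity
  have hc : PowerSeries.constantCoeff (1 + PowerSeries.X ^ (m * (k + 1)) : PowerSeries ℝ) ≠ 0 := by
    simp [hne]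
  have h1 : qFactor m (k + 1) - 1 = (PowerSeries.X ^ (k + 1) - PowerSeries.X ^ (m * (k + 1))) *
      (1 + PowerSeries.X ^ (m * (k + 1)))⁻¹ := by
    have := PowerSeries.mul_inv_cancel _ hc
    rw [qFactor]
    linear_combination this
  rw [h1]
  exact Dvd.dvd.mul_right (dvd_sub dvd_rfl (pow_dvd_pow _ (Nat.le_mul_of_pos_left _ hm))) _

theorem multipliable_qFactor_pow {m : ℕ} (hm : 0 < m) (h : ℕ) :
    Multipliable (fun k : ℕ => qFactor m (k + 1) ^ h) := by
  apply PowerSeries.multipliable_of_X_pow_dvd_sub_one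
  intro k
  have := sub_dvd_pow_sub_pow (qFactor m (k + 1)) 1 h
  rw [one_pow] at this
  exact (qFactor_sub_one_dvd hm k).trans this

/-- The factor `1 + X ^ (k + 1)`, omitted when `m` divides `k + 1`. -/
noncomputable def distinctFactor (m k : ℕ) : Polynomial ℝ :=
  if m ∣ k + 1 then 1 else 1 + Polynomial.X ^ (k + 1)

theorem distinctFactor_sub_one_dvd (m k : ℕ) :
    PowerSeries.X ^ (k + 1) ∣ (distinctFactor m k : PowerSeries ℝ) - 1 := by
  unfold distinctFactor
  split_ifs <;> simp

/-- Both sides are multiplied by the product of `1 + X ^ (m * k)`, reindexed as a product `v` over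
all exponents with trivial factors off the multiples of `m`. That product has constant coefficient
1, so it can be cancelled. -/
theorem qProduct_eq_tprod_distinctFactor {m : ℕ} (hm : 0 < m) :
    ∏' k : ℕ, qFactor m (k + 1) = ∏' k : ℕ, (distinctFactor m k : PowerSeries ℝ) := by
  set v : ℕ → PowerSeries ℝ := fun k => if m ∣ k + 1 then 1 + PowerSeries.X ^ (k + 1) else 1
    with hv
  have hvd : ∀ k, PowerSeries.X ^ (k + 1) ∣ v k - 1 := fun k => by
    rw [hv]; dsimp only; split_ifs <;> simp
  have hwd : ∀ k, PowerSeries.X ^ (k + 1) ∣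
      (1 + PowerSeries.X ^ (m * (k + 1)) : PowerSeries ℝ) - 1 := fun k => by
    simpa using pow_dvd_pow _ (Nat.le_mul_of_pos_left _ hm)
  have hD : ∏' k : ℕ, (1 + PowerSeries.X ^ (m * (k + 1)) : PowerSeries ℝ) = ∏' k, v k := by
    have hinj : Function.Injective (fun k : ℕ => m * (k + 1) - 1) := by
      intro a b hab
      have ha : 0 < m * (a + 1) := by positivity
      have hb : 0 < m * (b + 1) := by positivity
      have : m * (a + 1) = m * (b + 1) := by
        dsimp only at hab; omega
      simpa using Nat.eq_of_mul_eq_mul_left hm this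
    rw [← hinj.tprod_eq (f := v)]
    · refine tprod_congr fun k => ?_
      have ha : 0 < m * (k + 1) := by positivity
      have : m * (k + 1) - 1 + 1 = m * (k + 1) := by omega
      simp [hv, this]
    · intro k hk
      have hdvd : m ∣ k + 1 := by
        by_contra hcon
        exact hk (by simp [hv, hcon])
      obtain ⟨j, hj⟩ := hdvd
      have hj0 : j ≠ 0 := by rintro rfl; simp at hj
      refine ⟨j - 1, ?_⟩
      have : j - 1 + 1 = j := by omega
      simp only [this, ← hj]
      omega
  have hqm : Multipliable (fun k : ℕ => qFactor m (k + 1)) :=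
    PowerSeries.multipliable_of_X_pow_dvd_sub_one (qFactor_sub_one_dvd hm)
  have h1 : (∏' k : ℕ, qFactor m (k + 1)) * ∏' k, v k =
      (∏' k : ℕ, (distinctFactor m k : PowerSeries ℝ)) * ∏' k, v k := by
    nth_rewrite 1 [← hD]
    rw [← hqm.tprod_mul (PowerSeries.multipliable_of_X_pow_dvd_sub_one hwd),
      ← (PowerSeries.multipliable_of_X_pow_dvd_sub_one (distinctFactor_sub_one_dvd m)).tprod_mul
        (PowerSeries.multipliable_of_X_pow_dvd_sub_one hvd)]
    refine tprod_congr fun k => ?_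
    have hne : m * (k + 1) ≠ 0 := by positivity
    have hc : PowerSeries.constantCoeff (1 + PowerSeries.X ^ (m * (k + 1)) : PowerSeries ℝ) ≠ 0 := by
      simp [hne]
    rw [qFactor, mul_assoc, PowerSeries.inv_mul_cancel _ hc, hv, distinctFactor]
    by_cases hd : m ∣ k + 1 <;> simp [hd]
  exact mul_right_cancel₀ (PowerSeries.tprod_ne_zero_of_X_pow_dvd_sub_one hvd) h1

/-- Partial products are polynomials, so Cauchy's formula is needed only for polynomials; the
infinite product is reached by a limit. -/
theorem tendsto_coeff_prod_distinctFactor {m : ℕ} (hm : 0 < m) (h n : ℕ) :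
    Tendsto (fun N : ℕ => ((∏ k ∈ Finset.range N, distinctFactor m k) ^ h).coeff n) atTop
      (𝓝 (PowerSeries.coeff n (qProductPow m h))) := by
  have hM := PowerSeries.multipliable_of_X_pow_dvd_sub_one (distinctFactor_sub_one_dvd m)
  have hq : qProductPow m h = (∏' k : ℕ, (distinctFactor m k : PowerSeries ℝ)) ^ h := by
    rw [qProductPow, Multipliable.tprod_pow, qProduct_eq_tprod_distinctFactor hm]
    exact PowerSeries.multipliable_of_X_pow_dvd_sub_one (qFactor_sub_one_dvd hm)
  rw [hq]
  have h1 := (((PowerSeries.WithPiTopology.continuous_coeff ℝ n).tendsto _).comp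
    ((hM.hasProd.tendsto_prod_nat).pow h))
  refine h1.congr fun N => ?_
  have : ((∏ k ∈ Finset.range N, distinctFactor m k : Polynomial ℝ) : PowerSeries ℝ) =
      ∏ k ∈ Finset.range N, (distinctFactor m k : PowerSeries ℝ) :=
    by simp only [← Polynomial.coeToPowerSeries.ringHom_apply, map_prod]
  rw [Function.comp_apply, ← this, ← Polynomial.coe_pow, Polynomial.coeff_coe]

/-! ### Cauchy's integral for the coefficients. -/

theorem integral_exp_int_mul_I (k : ℤ) :
    ∫ θ in (-Real.pi)..Real.pi, Complex.exp (k * θ * Complex.I) =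
      if k = 0 then (2 * Real.pi : ℂ) else 0 := by
  split_ifs with hk
  · subst hk
    simp
    ring
  · have hk' : (k : ℂ) * Complex.I ≠ 0 := by simp [hk]
    have h := integral_exp_mul_complex (a := -Real.pi) (b := Real.pi) hk'
    have e : ∀ θ : ℝ, Complex.exp (k * θ * Complex.I) = Complex.exp (k * Complex.I * θ) := fun θ => by
      ring_nf
    simp only [e, h]
    have h2 : Complex.exp (k * Complex.I * (Real.pi : ℝ)) =
        Complex.exp (k * Complex.I * ((-Real.pi : ℝ) : ℂ)) := by
      rw [Complex.exp_eq_exp_iff_exists_int]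
      exact ⟨k, by push_cast; ring⟩
    rw [h2]
    simp

theorem Polynomial.coeff_eq_integral (p : Polynomial ℝ) (n : ℕ) (t : ℝ) :
    ((p.coeff n : ℝ) : ℂ) * (2 * Real.pi) = ∫ θ in (-Real.pi)..Real.pi,
      p.aeval (Complex.exp (-(t - θ * Complex.I))) * Complex.exp (n * (t - θ * Complex.I)) := by
  have e : ∀ θ : ℝ, p.aeval (Complex.exp (-(t - θ * Complex.I))) *
      Complex.exp (n * (t - θ * Complex.I)) = ∑ k ∈ p.support,
        ((p.coeff k : ℂ) * Complex.exp ((n - k) * t)) *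
          Complex.exp (((k - n : ℤ) : ℂ) * θ * Complex.I) := by
    intro θ
    rw [Polynomial.aeval_eq_sum_range' (Nat.lt_succ_self _), Finset.sum_mul]
    rw [← Finset.sum_subset (s₁ := p.support)]
    · refine Finset.sum_congr rfl fun k _ => ?_
      rw [← Complex.exp_nat_mul, Complex.real_smul, mul_assoc, mul_assoc, ← Complex.exp_add,
        ← Complex.exp_add]
      congr 2
      push_cast
      ring
    · exact Polynomial.supp_subset_range (Nat.lt_succ_self _)
    · intro k _ hk
      simp [Polynomial.notMem_support_iff.1 hk]
  simp only [e]
  rw [intervalIntegral.integral_finsetSum]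
  · simp only [intervalIntegral.integral_const_mul, integral_exp_int_mul_I]
    by_cases hn : n ∈ p.support
    · rw [Finset.sum_eq_single_of_mem n hn]
      · simp
      · intro k _ hk
        rw [if_neg, mul_zero]
        rw [sub_eq_zero]
        exact_mod_cast hk
    · rw [Finset.sum_eq_zero, Polynomial.notMem_support_iff.1 hn]
      · simp
      · intro k hk
        rw [if_neg, mul_zero]
        rw [sub_eq_zero]
        rintro h
        have : k = n := by exact_mod_cast h
        exact hn (this ▸ hk)
  · intro k _
    apply Continuous.intervalIntegrable
    fun_prop

/-- The sum of `log (1 + exp (-k z))` over the positive integers `k` not divisible by `m`. -/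
noncomputable def logSum (m : ℕ) (z : ℂ) : ℂ :=
  ∑' k : ℕ, if m ∣ k + 1 then 0 else Complex.log (1 + Complex.exp (-((k + 1 : ℕ) * z)))

theorem norm_exp_neg_nat_mul (k : ℕ) (z : ℂ) :
    ‖Complex.exp (-((k + 1 : ℕ) * z))‖ = Real.exp (-z.re) ^ (k + 1) := by
  rw [Complex.norm_exp, ← Real.exp_nat_mul]
  simp

theorem summable_log_one_add_exp {z : ℂ} (hz : 0 < z.re) :
    Summable fun k : ℕ => Complex.log (1 + Complex.exp (-((k + 1 : ℕ) * z))) := by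
  apply Complex.summable_log_one_add_of_summable
  apply Summable.of_norm
  simp only [norm_exp_neg_nat_mul]
  exact (summable_nat_add_iff 1).2
    (summable_geometric_of_lt_one (Real.exp_pos _).le (by simpa using hz))

theorem summable_logSum (m : ℕ) {z : ℂ} (hz : 0 < z.re) : Summable fun k : ℕ =>
    if m ∣ k + 1 then 0 else Complex.log (1 + Complex.exp (-((k + 1 : ℕ) * z))) := by
  refine Summable.of_norm_bounded (summable_log_one_add_exp hz).norm fun k => ?_
  split_ifs <;> simp

theorem one_add_exp_ne_zero {w : ℂ} (hw : 0 < w.re) : 1 + Complex.exp (-w) ≠ 0 := by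
  intro h
  have h1 : Complex.exp (-w) = -1 := by linear_combination h
  have h2 : ‖Complex.exp (-w)‖ = 1 := by simp [h1]
  rw [Complex.norm_exp] at h2
  simp at h2
  exact hw.ne' h2

theorem re_succ_mul_pos {z : ℂ} (hz : 0 < z.re) (k : ℕ) : 0 < (((k + 1 : ℕ) : ℂ) * z).re := by
  have : (((k + 1 : ℕ) : ℂ) * z).re = ((k + 1 : ℕ) : ℝ) * z.re := by simp
  rw [this]
  positivity

theorem aeval_distinctFactor (m k : ℕ) {z : ℂ} (hz : 0 < z.re) :
    (distinctFactor m k).aeval (Complex.exp (-z)) =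
      Complex.exp (if m ∣ k + 1 then 0 else Complex.log (1 + Complex.exp (-((k + 1 : ℕ) * z)))) := by
  unfold distinctFactor
  split_ifs
  · simp
  · rw [Complex.exp_log (one_add_exp_ne_zero (re_succ_mul_pos hz k))]
    simp only [map_add, map_one, map_pow, Polynomial.aeval_X, ← Complex.exp_nat_mul]
    congr 2
    ring

theorem aeval_prod_distinctFactor (m h N : ℕ) {z : ℂ} (hz : 0 < z.re) :
    ((∏ k ∈ Finset.range N, distinctFactor m k) ^ h).aeval (Complex.exp (-z)) =
      Complex.exp (h * ∑ k ∈ Finset.range N, if m ∣ k + 1 then 0 else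
        Complex.log (1 + Complex.exp (-((k + 1 : ℕ) * z)))) := by
  rw [map_pow, map_prod, Complex.exp_nat_mul, Complex.exp_sum]
  congr 1
  exact Finset.prod_congr rfl fun k _ => aeval_distinctFactor m k hz

/-- Dominated convergence on a fixed circle: since `1 + x ≤ exp x`, every partial product is bounded
by the exponential of a geometric series in `exp (-t)`, uniformly in `N` and `θ`. -/
theorem coeff_qProductPow_eq_integral {m : ℕ} (hm : 0 < m) (h n : ℕ) {t : ℝ} (ht : 0 < t) :
    ((PowerSeries.coeff n (qProductPow m h) : ℝ) : ℂ) * (2 * Real.pi) =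
      ∫ θ in (-Real.pi)..Real.pi, Complex.exp (h * logSum m (t - θ * Complex.I)) *
        Complex.exp (n * (t - θ * Complex.I)) := by
  have h1 : Tendsto (fun N : ℕ =>
      ((((∏ k ∈ Finset.range N, distinctFactor m k) ^ h).coeff n : ℝ) : ℂ) * (2 * Real.pi)) atTop
      (𝓝 (((PowerSeries.coeff n (qProductPow m h) : ℝ) : ℂ) * (2 * Real.pi))) :=
    ((Complex.continuous_ofReal.tendsto _).comp
      (tendsto_coeff_prod_distinctFactor hm h n)).mul_const _
  refine tendsto_nhds_unique h1 ?_
  simp only [Polynomial.coeff_eq_integral _ n t]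
  have hre : ∀ θ : ℝ, ((t : ℂ) - θ * Complex.I).re = t := fun θ => by simp
  have hz : ∀ θ : ℝ, 0 < ((t : ℂ) - θ * Complex.I).re := fun θ => by rw [hre]; exact ht
  obtain ⟨C, hC⟩ : ∃ C : ℝ, ∀ N : ℕ, ∀ θ : ℝ,
      ‖(((∏ k ∈ Finset.range N, distinctFactor m k) ^ h).aeval
        (Complex.exp (-(t - θ * Complex.I))) : ℂ)‖ ≤ C := by
    refine ⟨Real.exp (∑' k : ℕ, Real.exp (-t) ^ (k + 1)) ^ h, fun N θ => ?_⟩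
    have hsum : Summable fun k : ℕ => Real.exp (-t) ^ (k + 1) := (summable_nat_add_iff 1).2
      (summable_geometric_of_lt_one (Real.exp_pos _).le (by simpa using ht))
    rw [map_pow, norm_pow, map_prod, norm_prod]
    refine pow_le_pow_left₀ (Finset.prod_nonneg fun _ _ => norm_nonneg _) ?_ _
    calc _ ≤ ∏ k ∈ Finset.range N, Real.exp (Real.exp (-t) ^ (k + 1)) := by
          refine Finset.prod_le_prod (fun _ _ => norm_nonneg _) fun k _ => ?_
          have h0 : 0 ≤ Real.exp (-t) ^ (k + 1) := by positivity
          unfold distinctFactor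
          split_ifs
          · simpa using h0
          · rw [map_add, map_one, map_pow, Polynomial.aeval_X]
            refine (norm_add_le _ _).trans ?_
            rw [norm_one, norm_pow, Complex.norm_exp, Complex.neg_re, hre, add_comm]
            exact Real.add_one_le_exp _
      _ = Real.exp (∑ k ∈ Finset.range N, Real.exp (-t) ^ (k + 1)) := (Real.exp_sum _ _).symm
      _ ≤ _ := Real.exp_le_exp.2 (hsum.sum_le_tsum _ fun k _ => by positivity)
  apply intervalIntegral.tendsto_integral_filter_of_dominated_convergence
    (fun _ => C * Real.exp (n * t))
  · refine Eventually.of_forall fun N => Continuous.aestronglyMeasurable ?_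
    have hp : Continuous fun w : ℂ =>
        (((∏ k ∈ Finset.range N, distinctFactor m k) ^ h).aeval w : ℂ) :=
      Polynomial.continuous_aeval _
    exact (hp.comp (by fun_prop)).mul (by fun_prop)
  · refine Eventually.of_forall fun N => Eventually.of_forall fun θ _ => ?_
    rw [norm_mul]
    refine mul_le_mul (hC N θ) ?_ (norm_nonneg _) ((norm_nonneg _).trans (hC N θ))
    rw [Complex.norm_exp]
    simp
  · exact intervalIntegrable_const
  · refine Eventually.of_forall fun θ _ => ?_
    refine Tendsto.mul_const _ ?_
    simp only [aeval_prod_distinctFactor _ _ _ (hz θ)]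
    exact (Complex.continuous_exp.tendsto _).comp
      ((summable_logSum m (hz θ)).hasSum.tendsto_sum_nat.const_mul _)

/-! ### Decay of the integrand away from the real axis. -/

/-- With `d = ‖w‖ - Re w` one has `‖1 + w‖² = (1 + ‖w‖)² - 2 d`. As `(1 + ‖w‖)² ≤ 4`, this is at
most `(1 + ‖w‖)² (1 - d / 2)`, and `1 - d / 2 ≤ exp (-d / 2)`. -/
theorem norm_one_add_le_mul_exp {w : ℂ} (hw : ‖w‖ ≤ 1) :
    ‖1 + w‖ ≤ (1 + ‖w‖) * Real.exp (-((‖w‖ - w.re) / 4)) := by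
  have h0 := norm_nonneg w
  have hre : w.re ≤ ‖w‖ := Complex.re_le_norm w
  apply le_of_sq_le_sq _ (by positivity)
  have h1 : ‖1 + w‖ ^ 2 = (1 + ‖w‖) ^ 2 - 2 * (‖w‖ - w.re) := by
    rw [Complex.sq_norm, Complex.normSq_add, ← Complex.sq_norm, ← Complex.sq_norm]
    simp
    ring
  have h2 : Real.exp (-((‖w‖ - w.re) / 4)) ^ 2 = Real.exp (-((‖w‖ - w.re) / 2)) := by
    rw [← Real.exp_nat_mul]
    congr 1
    push_cast
    ring
  have h3 := Real.add_one_le_exp (-((‖w‖ - w.re) / 2))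
  rw [h1, mul_pow, h2]
  nlinarith [mul_le_mul_of_nonneg_left h3 (sq_nonneg (1 + ‖w‖)),
    mul_nonneg (sub_nonneg.2 hre) (sub_nonneg.2 hw)]

/-- The sum of `exp (-k t) (1 - cos (k θ))` over the positive integers `k` not divisible by `m`. -/
noncomputable def cosDefect (m : ℕ) (t θ : ℝ) : ℝ :=
  ∑' k : ℕ, if m ∣ k + 1 then 0 else
    Real.exp (-((k + 1 : ℕ) * t)) * (1 - Real.cos ((k + 1 : ℕ) * θ))

theorem cosDefect_term_nonneg (m k : ℕ) (t θ : ℝ) : 0 ≤ (if m ∣ k + 1 then 0 else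
    Real.exp (-((k + 1 : ℕ) * t)) * (1 - Real.cos ((k + 1 : ℕ) * θ)) : ℝ) := by
  split_ifs
  · exact le_rfl
  · exact mul_nonneg (Real.exp_pos _).le (sub_nonneg.2 (Real.cos_le_one _))

theorem summable_cosDefect (m : ℕ) {t : ℝ} (ht : 0 < t) (θ : ℝ) : Summable fun k : ℕ =>
    (if m ∣ k + 1 then 0 else
      Real.exp (-((k + 1 : ℕ) * t)) * (1 - Real.cos ((k + 1 : ℕ) * θ)) : ℝ) := by
  have hg : Summable fun k : ℕ => Real.exp (-t) ^ (k + 1) * 2 := ((summable_nat_add_iff 1).2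
    (summable_geometric_of_lt_one (Real.exp_pos _).le (by simpa using ht))).mul_right 2
  refine Summable.of_nonneg_of_le (fun k => cosDefect_term_nonneg m k t θ) (fun k => ?_) hg
  split_ifs
  · positivity
  · rw [← Real.exp_nat_mul, mul_neg]
    gcongr
    linarith [Real.neg_one_le_cos ((k + 1 : ℕ) * θ)]

theorem re_logSum_le (m : ℕ) {t : ℝ} (ht : 0 < t) (θ : ℝ) :
    (logSum m (t - θ * Complex.I)).re ≤ (logSum m t).re - cosDefect m t θ / 4 := by
  have hz : 0 < ((t : ℂ) - θ * Complex.I).re := by simpa using ht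
  have hz0 : 0 < (t : ℂ).re := by simpa using ht
  rw [logSum, logSum, cosDefect, Complex.re_tsum (summable_logSum m hz),
    Complex.re_tsum (summable_logSum m hz0), ← tsum_div_const,
    ← Summable.tsum_sub (Complex.hasSum_re (summable_logSum m hz0).hasSum).summable
      ((summable_cosDefect m ht θ).div_const 4)]
  refine Summable.tsum_le_tsum (fun k => ?_)
    (Complex.hasSum_re (summable_logSum m hz).hasSum).summable
    ((Complex.hasSum_re (summable_logSum m hz0).hasSum).summable.sub
      ((summable_cosDefect m ht θ).div_const 4))
  by_cases hk : m ∣ k + 1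
  · simp [hk]
  · simp only [hk, if_false, Complex.log_re]
    set w := Complex.exp (-((k + 1 : ℕ) * (t - θ * Complex.I))) with hwdef
    have hn : ‖w‖ = Real.exp (-((k + 1 : ℕ) * t)) := by
      rw [hwdef, Complex.norm_exp]; simp
    have hr : w.re = Real.exp (-((k + 1 : ℕ) * t)) * Real.cos ((k + 1 : ℕ) * θ) := by
      rw [hwdef, Complex.exp_re]; simp
    have hpos : 0 ≤ ((k + 1 : ℕ) : ℝ) * t := by positivity
    have h1 : ‖w‖ ≤ 1 := by rw [hn]; simpa using hpos
    have hne : 0 < ‖1 + w‖ := norm_pos_iff.2 (one_add_exp_ne_zero (re_succ_mul_pos hz k))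
    have h2 := Real.log_le_log hne (norm_one_add_le_mul_exp h1)
    rw [Real.log_mul (by positivity) (Real.exp_pos _).ne', Real.log_exp, hn, hr] at h2
    have h3 : ‖1 + Complex.exp (-((k + 1 : ℕ) * (t : ℂ)))‖ = 1 + Real.exp (-((k + 1 : ℕ) * t)) := by
      have : (1 + Complex.exp (-((k + 1 : ℕ) * (t : ℂ)))) =
          ((1 + Real.exp (-((k + 1 : ℕ) * t)) : ℝ) : ℂ) := by push_cast; rfl
      rw [this, Complex.norm_real, Real.norm_of_nonneg (by positivity)]
    rw [h3]
    linarith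

/-- Only the residue class `k ≡ 1 (mod m)` is kept: it avoids the multiples of `m` and already
yields enough decay. The shift `s` allows terms to be paired later. -/
theorem sum_range_le_cosDefect {m : ℕ} (hm : 1 < m) {t : ℝ} (ht : 0 < t) (θ : ℝ) (s N : ℕ) :
    ∑ l ∈ Finset.range N, Real.exp (-((m * (l + s) + 1 : ℝ) * t)) *
      (1 - Real.cos ((m * (l + s) + 1 : ℝ) * θ)) ≤ cosDefect m t θ := by
  have hinj : Function.Injective (fun l : ℕ => m * (l + s)) := fun a b hab => by
    have := Nat.eq_of_mul_eq_mul_left (by omega) hab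
    omega
  have h := (summable_cosDefect m ht θ).sum_le_tsum ((Finset.range N).image fun l => m * (l + s))
    fun k _ => cosDefect_term_nonneg m k t θ
  rw [Finset.sum_image hinj.injOn] at h
  refine le_trans (le_of_eq (Finset.sum_congr rfl fun l _ => ?_)) h
  have : ¬ m ∣ m * (l + s) + 1 := by
    rw [Nat.dvd_add_right (dvd_mul_right _ _), Nat.dvd_one]
    omega
  simp [this]

/-- As `1 - cos x = ‖1 - exp (i x)‖² / 2`, this is the triangle inequality followed by `(p + q)² ≤ 2
p² + 2 q²`. -/
theorem one_sub_cos_sub_le (a b : ℝ) :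
    1 - Real.cos (a - b) ≤ 2 * (1 - Real.cos a) + 2 * (1 - Real.cos b) := by
  rw [Real.cos_sub]
  nlinarith [Real.sin_sq_add_cos_sq a, Real.sin_sq_add_cos_sq b,
    sq_nonneg (Real.cos a + Real.cos b - 2), sq_nonneg (Real.sin a + Real.sin b)]

/-- The least multiple of `|φ|` reaching `π / 2` overshoots by at most `|φ| ≤ π`, so it stays below
`3 π / 2`. -/
theorem exists_nat_mul_cos_nonpos {φ : ℝ} (h0 : 0 < |φ|) (hpi : |φ| ≤ Real.pi) :
    ∃ s : ℕ, Real.cos (s * φ) ≤ 0 ∧ s * |φ| ≤ Real.pi / 2 + |φ| := by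
  refine ⟨⌈Real.pi / 2 / |φ|⌉₊, ?_, ?_⟩
  · have h1 := Nat.le_ceil (Real.pi / 2 / |φ|)
    have h2 := Nat.ceil_lt_add_one (a := Real.pi / 2 / |φ|) (by positivity)
    set s : ℝ := (⌈Real.pi / 2 / |φ|⌉₊ : ℝ)
    rw [div_le_iff₀ h0] at h1
    have h3 : s * |φ| ≤ Real.pi / 2 + |φ| := by
      have := mul_le_mul_of_nonneg_right h2.le h0.le
      rwa [add_mul, div_mul_cancel₀ _ h0.ne', one_mul] at this
    have h4 : Real.cos (s * φ) = Real.cos (s * |φ|) := by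
      rcases abs_choice φ with h | h <;> rw [h]
      rw [mul_neg, Real.cos_neg]
    rw [h4]
    exact Real.cos_nonpos_of_pi_div_two_le_of_le h1 (by linarith)
  · have h2 := Nat.ceil_lt_add_one (a := Real.pi / 2 / |φ|) (by positivity)
    have := mul_le_mul_of_nonneg_right h2.le h0.le
    rwa [add_mul, div_mul_cancel₀ _ h0.ne', one_mul] at this

theorem cube_le_three_mul_sum_sq (M : ℕ) :
    (M : ℝ) ^ 3 ≤ 3 * ∑ l ∈ Finset.range M, ((l : ℝ) + 1) ^ 2 := by
  induction M with
  | zero => simp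
  | succ M ih =>
    rw [Finset.sum_range_succ]
    push_cast
    have : (0 : ℝ) ≤ M := M.cast_nonneg
    nlinarith

/-- About `1 / t` terms `k = m l + 1` have weight bounded below. Their angles advance by `φ`, the
reduction of `m θ` modulo `2π`. If `φ` is not tiny, the angles spread out. If it is tiny, `θ` is
near a multiple of `2π / m`: near 0 the defect is quadratic in `θ`, while near a nonzero multiple
every angle stays close to `θ`, away from 0 modulo `2π`. -/
theorem exists_le_cosDefect {m : ℕ} (hm : 1 < m) : ∃ c : ℝ, 0 < c ∧ ∀ t θ : ℝ, 0 < t → t ≤ 1 →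
    |θ| ≤ Real.pi → c / t ≤ cosDefect m t θ ∨ c * θ ^ 2 / t ^ 3 ≤ cosDefect m t θ := by
  have hm1 : (1 : ℝ) ≤ m := by exact_mod_cast hm.le
  have hm0 : (0 : ℝ) < m := by linarith
  -- Least weight in use: `l t ≤ 1`, `s t ≤ 2 m + 1` and `t ≤ 1` give `(m (l + s) + 1) t ≤ 2 m² + 2
  -- m + 1`.
  set δ : ℝ := Real.exp (-(2 * m ^ 2 + 2 * m + 1)) with hδ
  have hδ0 : 0 < δ := Real.exp_pos _
  -- The constant lies below those of the three cases: `δ / 4`, `δ / (2 m²)` and `δ / 15`.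
  refine ⟨δ / (15 * m ^ 2), by positivity, fun t θ ht ht1 hθ => ?_⟩
  have hc1 : δ / (15 * m ^ 2) ≤ δ / 4 := by gcongr; nlinarith
  have hc2 : δ / (15 * m ^ 2) ≤ δ / (2 * m ^ 2) := by gcongr; norm_num
  have hc3 : δ / (15 * m ^ 2) ≤ δ / 15 := by gcongr; nlinarith
  set M : ℕ := ⌊1 / t⌋₊ + 1 with hM
  have hMt : 1 / t ≤ M := by
    rw [hM]; push_cast; exact (Nat.lt_floor_add_one _).le
  have hl : ∀ l ∈ Finset.range M, (l : ℝ) * t ≤ 1 := fun l hl => by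
    have h1 : l ≤ ⌊1 / t⌋₊ := by
      have := Finset.mem_range.1 hl; omega
    have h2 : (l : ℝ) ≤ 1 / t := (Nat.cast_le.2 h1).trans (Nat.floor_le (by positivity))
    rwa [le_div_iff₀ ht] at h2
  have hweight : ∀ (s : ℕ), (s : ℝ) * t ≤ 2 * m + 1 → ∀ l ∈ Finset.range M,
      δ ≤ Real.exp (-((m * (l + s) + 1 : ℝ) * t)) := fun s hs l hlM => by
    apply Real.exp_le_exp.2
    have := mul_le_mul_of_nonneg_left (hl l hlM) hm0.le
    have := mul_le_mul_of_nonneg_left hs hm0.le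
    nlinarith
  have hconst : ∀ e : ℝ, 0 ≤ e → e / t ≤ ∑ l ∈ Finset.range M, e := fun e he => by
    rw [Finset.sum_const, Finset.card_range, nsmul_eq_mul, div_eq_mul_one_div, mul_comm]
    exact mul_le_mul_of_nonneg_right hMt he
  have hdef := fun s N => sum_range_le_cosDefect hm ht θ s N
  have hcos : ∀ x : ℝ, 0 ≤ 1 - Real.cos x := fun x => sub_nonneg.2 (Real.cos_le_one x)
  set j : ℤ := round (m * θ / (2 * Real.pi)) with hj
  set φ : ℝ := m * θ - j * (2 * Real.pi) with hφ
  have hφpi : |φ| ≤ Real.pi := by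
    have h1 := abs_sub_round (m * θ / (2 * Real.pi))
    have h2 : φ = (m * θ / (2 * Real.pi) - j) * (2 * Real.pi) := by
      rw [hφ]; field_simp
    rw [h2, abs_mul, abs_of_pos Real.two_pi_pos]
    nlinarith [Real.pi_pos]
  rcases le_or_gt (t / m) |φ| with hbig | hsmall
  · left
    obtain ⟨s, hs1, hs2⟩ := exists_nat_mul_cos_nonpos (lt_of_lt_of_le (by positivity) hbig) hφpi
    have hst : (s : ℝ) * t ≤ 2 * m + 1 := by
      have hpos : 0 < |φ| := lt_of_lt_of_le (by positivity) hbig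
      rw [div_le_iff₀ hm0] at hbig
      by_contra! hcon
      have h1 : (s : ℝ) * t ≤ s * (|φ| * m) := mul_le_mul_of_nonneg_left hbig s.cast_nonneg
      have h2 : (s : ℝ) ≤ Real.pi / 2 / |φ| + 1 := by
        rw [div_add_one hpos.ne', le_div_iff₀ hpos]; exact hs2
      have h3 : (s : ℝ) * t ≤ (Real.pi / 2 / |φ| + 1) * t := mul_le_mul_of_nonneg_right h2 ht.le
      have h4 : Real.pi / 2 / |φ| * t ≤ Real.pi / 2 * m := by
        rw [div_mul_eq_mul_div, div_le_iff₀ hpos]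
        nlinarith [Real.pi_pos]
      nlinarith [Real.pi_lt_four]
    -- The angles at `l` and `l + s` differ by `s φ` modulo `2π`, whose cosine is nonpositive, so
    -- they cannot both be near 0.
    have hpair : ∀ l ∈ Finset.range M, δ * (1 / 2) ≤
        Real.exp (-((m * (l + (0 : ℕ)) + 1 : ℝ) * t)) *
          (1 - Real.cos ((m * (l + (0 : ℕ)) + 1 : ℝ) * θ)) +
        Real.exp (-((m * (l + s) + 1 : ℝ) * t)) *
          (1 - Real.cos ((m * (l + s) + 1 : ℝ) * θ)) := fun l hlM => by
      have h1 := hweight s hst l hlM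
      have h2 := hweight 0 (by simp; linarith) l hlM
      have h3 := one_sub_cos_sub_le ((m * (l + s) + 1 : ℝ) * θ) ((m * (l + (0 : ℕ)) + 1 : ℝ) * θ)
      have h4 : (m * (l + s) + 1 : ℝ) * θ - (m * (l + (0 : ℕ)) + 1 : ℝ) * θ =
          s * φ + ((s * j : ℤ) : ℝ) * (2 * Real.pi) := by
        rw [hφ]; push_cast; ring
      rw [h4, Real.cos_add_int_mul_two_pi] at h3
      have h5 := mul_le_mul_of_nonneg_right h1 (hcos ((m * (l + s) + 1 : ℝ) * θ))
      have h6 := mul_le_mul_of_nonneg_right h2 (hcos ((m * (l + (0 : ℕ)) + 1 : ℝ) * θ))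
      refine le_trans ?_ (add_le_add h6 h5)
      rw [← mul_add]
      refine mul_le_mul_of_nonneg_left ?_ hδ0.le
      generalize Real.cos ((m * (l + (0 : ℕ)) + 1 : ℝ) * θ) = y at h3 ⊢
      linarith
    have h7 := (hconst _ (by positivity)).trans (Finset.sum_le_sum hpair)
    rw [Finset.sum_add_distrib] at h7
    have h8 : δ / 4 / t ≤ cosDefect m t θ := by
      have : δ * (1 / 2) / t = 2 * (δ / 4 / t) := by ring
      have := h7.trans (add_le_add (hdef 0 M) (hdef s M))
      linarith
    exact (div_le_div_of_nonneg_right hc1 ht.le).trans h8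
  · have hlφ : ∀ l ∈ Finset.range M, l * |φ| ≤ 1 / m := fun l hlM => by
      have h1 := mul_le_mul_of_nonneg_left hsmall.le (Nat.cast_nonneg (α := ℝ) l)
      refine h1.trans ?_
      rw [← mul_div_assoc]
      exact div_le_div_of_nonneg_right (hl l hlM) hm0.le
    by_cases hj0 : j = 0
    · right
      have hφθ : φ = m * θ := by rw [hφ, hj0]; simp
      have hterm : ∀ l ∈ Finset.range M, δ / 5 * θ ^ 2 * ((l : ℝ) + 1) ^ 2 ≤
          Real.exp (-((m * (l + (0 : ℕ)) + 1 : ℝ) * t)) *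
            (1 - Real.cos ((m * (l + (0 : ℕ)) + 1 : ℝ) * θ)) := fun l hlM => by
        have h2 := hweight 0 (by simp; linarith) l hlM
        have h1 := hlφ l hlM
        have hmi : 1 / (m : ℝ) ≤ 1 := by rw [div_le_one hm0]; exact hm1
        have hθ1 : |θ| ≤ 1 := by
          have h3 : m * |θ| ≤ t / m := by
            rw [← abs_of_pos hm0, ← abs_mul, ← hφθ]
            rw [abs_of_pos hm0]
            exact hsmall.le
          have h4 : t / m ≤ 1 := by rw [div_le_one hm0]; linarith
          nlinarith [abs_nonneg θ]
        have hang : |(m * (l + (0 : ℕ)) + 1 : ℝ) * θ| ≤ Real.pi := by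
          have e : (m * (l + (0 : ℕ)) + 1 : ℝ) * θ = l * φ + θ := by
            rw [hφθ]; push_cast; ring
          rw [e]
          refine (abs_add_le _ _).trans ?_
          rw [abs_mul, Nat.abs_cast]
          linarith [Real.pi_gt_three]
        have h5 := Real.cos_le_one_sub_mul_cos_sq hang
        have h6 : 1 / 5 ≤ 2 / Real.pi ^ 2 := by
          rw [div_le_div_iff₀ (by norm_num) (by positivity)]
          nlinarith [Real.pi_gt_three, Real.pi_lt_d2]
        have h7 : ((l : ℝ) + 1) ^ 2 ≤ (m * (l + (0 : ℕ)) + 1 : ℝ) ^ 2 := by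
          have : (0 : ℝ) ≤ l := l.cast_nonneg
          apply pow_le_pow_left₀ (by positivity)
          push_cast
          nlinarith
        have h8 : 1 / 5 * (((l : ℝ) + 1) ^ 2 * θ ^ 2) ≤
            1 - Real.cos ((m * (l + (0 : ℕ)) + 1 : ℝ) * θ) := by
          have h9 : 2 / Real.pi ^ 2 * ((m * (l + (0 : ℕ)) + 1 : ℝ) * θ) ^ 2 ≤
            1 - Real.cos ((m * (l + (0 : ℕ)) + 1 : ℝ) * θ) := by linarith
          refine le_trans ?_ h9
          rw [mul_pow]
          gcongr
        calc δ / 5 * θ ^ 2 * ((l : ℝ) + 1) ^ 2 = δ * (1 / 5 * (((l : ℝ) + 1) ^ 2 * θ ^ 2)) := by ring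
          _ ≤ _ := mul_le_mul h2 h8 (by positivity) (Real.exp_pos _).le
      have h1 := (Finset.sum_le_sum hterm).trans (hdef 0 M)
      rw [← Finset.mul_sum] at h1
      have h2 := cube_le_three_mul_sum_sq M
      have h3 : (1 / t) ^ 3 ≤ (M : ℝ) ^ 3 := pow_le_pow_left₀ (by positivity) hMt 3
      calc δ / (15 * m ^ 2) * θ ^ 2 / t ^ 3 = δ / (15 * m ^ 2) * (θ ^ 2 * (1 / t) ^ 3) := by ring
        _ ≤ δ / 15 * (θ ^ 2 * (3 * ∑ l ∈ Finset.range M, ((l : ℝ) + 1) ^ 2)) := by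
          gcongr
          exact h3.trans h2
        _ = δ / 5 * θ ^ 2 * ∑ l ∈ Finset.range M, ((l : ℝ) + 1) ^ 2 := by ring
        _ ≤ _ := h1
    · left
      have hθm : Real.pi ≤ m * |θ| := by
        have hj1 : (1 : ℝ) ≤ |(j : ℝ)| := by
          exact_mod_cast Int.one_le_abs hj0
        have h1 : m * θ = φ + j * (2 * Real.pi) := by rw [hφ]; ring
        have h2 : |(j : ℝ) * (2 * Real.pi)| ≤ |m * θ| + |φ| := by
          have : (j : ℝ) * (2 * Real.pi) = m * θ - φ := by rw [hφ]; ring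
          rw [this]; exact abs_sub _ _
        rw [abs_mul, abs_of_pos Real.two_pi_pos, abs_mul, abs_of_pos hm0] at h2
        nlinarith [Real.pi_pos]
      have hcosθ : 2 / (m : ℝ) ^ 2 ≤ 1 - Real.cos θ := by
        have h1 := Real.cos_le_one_sub_mul_cos_sq hθ
        have h2 : 2 / (m : ℝ) ^ 2 ≤ 2 / Real.pi ^ 2 * θ ^ 2 := by
          rw [div_mul_eq_mul_div, div_le_div_iff₀ (by positivity) (by positivity)]
          have := pow_le_pow_left₀ Real.pi_pos.le hθm 2
          rw [mul_pow, sq_abs] at this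
          linarith
        linarith
      have hterm : ∀ l ∈ Finset.range M, δ * (1 / (2 * m ^ 2)) ≤
          Real.exp (-((m * (l + (0 : ℕ)) + 1 : ℝ) * t)) *
            (1 - Real.cos ((m * (l + (0 : ℕ)) + 1 : ℝ) * θ)) := fun l hlM => by
        have h2 := hweight 0 (by simp; linarith) l hlM
        have h3 := one_sub_cos_sub_le (θ + l * φ) (l * φ)
        have h4 : (m * (l + (0 : ℕ)) + 1 : ℝ) * θ =
            θ + l * φ + ((l * j : ℤ) : ℝ) * (2 * Real.pi) := by
          rw [hφ]; push_cast; ring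
        have h5 := Real.one_sub_sq_div_two_le_cos (x := l * φ)
        have h6 : (l * φ) ^ 2 ≤ 1 / (m : ℝ) ^ 2 := by
          have := pow_le_pow_left₀ (by positivity) (hlφ l hlM) 2
          rw [mul_pow, sq_abs] at this
          rw [mul_pow]
          refine this.trans (le_of_eq ?_)
          rw [div_pow, one_pow]
        rw [add_sub_cancel_right] at h3
        refine mul_le_mul h2 ?_ (by positivity) (Real.exp_pos _).le
        rw [h4, Real.cos_add_int_mul_two_pi]
        have h7 : 2 / (m : ℝ) ^ 2 = 4 * (1 / (2 * m ^ 2)) := by field_simp; norm_num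
        have h8 : 1 / (m : ℝ) ^ 2 = 2 * (1 / (2 * m ^ 2)) := by field_simp
        linarith
      have h1 := ((hconst _ (by positivity)).trans (Finset.sum_le_sum hterm)).trans (hdef 0 M)
      refine le_trans ?_ h1
      apply div_le_div_of_nonneg_right _ ht.le
      rw [mul_one_div]
      exact hc2

/-! ### Asymptotics of `logSum` in the cone `|Im z| ≤ Re z`. -/

/-- The trapezoid rule is exact on affine functions, so the tangent line at `a` may be subtracted;
the remainder varies by at most `M`. The crude constant suffices. -/
theorem norm_integral_sub_trapezoid_le {g g' g'' : ℝ → ℂ} {a M : ℝ}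
    (hg : ∀ x ∈ Set.Icc a (a + 1), HasDerivAt g (g' x) x)
    (hg' : ∀ x ∈ Set.Icc a (a + 1), HasDerivAt g' (g'' x) x)
    (hM : ∀ x ∈ Set.Icc a (a + 1), ‖g'' x‖ ≤ M) :
    ‖(∫ x in a..(a + 1), g x) - (g a + g (a + 1)) / 2‖ ≤ 3 / 2 * M := by
  have ha : a ∈ Set.Icc a (a + 1) := by simp
  have hb : a + 1 ∈ Set.Icc a (a + 1) := by simp
  have hM0 : 0 ≤ M := (norm_nonneg _).trans (hM a ha)
  have h1 : ∀ x ∈ Set.Icc a (a + 1), ‖g' x - g' a‖ ≤ M := fun x hx => by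
    have := norm_image_sub_le_of_norm_deriv_le_segment'
      (fun y hy => (hg' y hy).hasDerivWithinAt) (fun y hy => hM y (Set.Ico_subset_Icc_self hy)) x hx
    refine this.trans ?_
    have : x - a ≤ 1 := by linarith [hx.2]
    nlinarith
  set r : ℝ → ℂ := fun x => g x - g' a * (x - a : ℝ) with hr
  have hrd : ∀ x ∈ Set.Icc a (a + 1), HasDerivAt r (g' x - g' a) x := fun x hx => by
    have h2 : HasDerivAt (fun y : ℝ => ((y - a : ℝ) : ℂ)) ((1 : ℝ) : ℂ) x :=
      ((hasDerivAt_id x).sub_const a).ofReal_comp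
    convert! (hg x hx).sub (h2.const_mul (g' a)) using 1
    simp
  have h2 : ∀ x ∈ Set.Icc a (a + 1), ‖r x - r a‖ ≤ M := fun x hx => by
    have := norm_image_sub_le_of_norm_deriv_le_segment'
      (fun y hy => (hrd y hy).hasDerivWithinAt) (fun y hy => h1 y (Set.Ico_subset_Icc_self hy)) x hx
    refine this.trans ?_
    have : x - a ≤ 1 := by linarith [hx.2]
    nlinarith
  have hgi : IntervalIntegrable g volume a (a + 1) := by
    apply ContinuousOn.intervalIntegrable
    rw [Set.uIcc_of_le (by linarith)]
    exact fun x hx => (hg x hx).continuousAt.continuousWithinAt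
  have hlin : (∫ x in a..(a + 1), g' a * ((x - a : ℝ) : ℂ)) = g' a / 2 := by
    rw [intervalIntegral.integral_const_mul, intervalIntegral.integral_ofReal]
    simp
    ring
  have h3 : (∫ x in a..(a + 1), (r x - r a)) = (∫ x in a..(a + 1), g x) - g' a / 2 - g a := by
    simp only [hr]
    rw [intervalIntegral.integral_sub, intervalIntegral.integral_sub hgi, hlin]
    · simp
    · apply Continuous.intervalIntegrable; fun_prop
    · exact hgi.sub (by apply Continuous.intervalIntegrable; fun_prop)
    · simp
  have h4 : ‖∫ x in a..(a + 1), (r x - r a)‖ ≤ M := by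
    have := intervalIntegral.norm_integral_le_of_norm_le_const (a := a) (b := a + 1) (C := M)
      (f := fun x => r x - r a) fun x hx => by
        rw [Set.uIoc_of_le (by linarith)] at hx
        exact h2 x (Set.Ioc_subset_Icc_self hx)
    simpa using this
  have h5 : (∫ x in a..(a + 1), g x) - (g a + g (a + 1)) / 2 =
      (∫ x in a..(a + 1), (r x - r a)) - (r (a + 1) - r a) / 2 := by
    rw [h3, hr]
    simp
    ring
  rw [h5]
  refine (norm_sub_le _ _).trans ?_
  have h6 := h2 _ hb
  rw [norm_div, Complex.norm_ofNat]
  linarith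

/-- The Fourier series of the second Bernoulli polynomial at `1 / 2`. The term `n = 0` vanishes
because division by zero gives 0. -/
theorem hasSum_alternating_inv_sq :
    HasSum (fun n : ℕ => (-1 : ℝ) ^ (n + 1) / (n : ℝ) ^ 2) (Real.pi ^ 2 / 12) := by
  have h := hasSum_one_div_nat_pow_mul_cos one_ne_zero (x := 1 / 2) (by norm_num)
  have hB : Polynomial.eval (1 / 2 : ℝ) (Polynomial.map (algebraMap ℚ ℝ)
      (Polynomial.bernoulli (2 * 1))) = -1 / 12 := by
    simp [Polynomial.bernoulli, Finset.sum_range_succ, bernoulli_one, bernoulli_zero, bernoulli_two]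
    norm_num
  rw [hB] at h
  have h2 := h.neg
  convert! h2 using 1
  · funext n
    have : 2 * Real.pi * n * (1 / 2) = n * Real.pi := by ring
    rw [this, Real.cos_nat_mul_pi]
    simp only [mul_one, pow_succ]
    ring
  · simp
    ring

section Cone

variable {z : ℂ}

/-- For `x Re z ≤ 1` the cone keeps the argument of the exponential within `[-1, 1]`, so its real
part is nonnegative; beyond that its norm is at most `1 / e`. This keeps `log` off its cut and
denominators away from 0. -/
theorem half_le_re_one_add_exp (hz : |z.im| ≤ z.re) {x : ℝ} (hx : 0 ≤ x) :
    1 / 2 ≤ (1 + Complex.exp (-(x * z))).re := by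
  have hE : ‖Complex.exp (-(x * z))‖ = Real.exp (-(x * z.re)) := by
    rw [Complex.norm_exp]; simp
  rcases le_total (x * z.re) 1 with h | h
  · have h1 : 0 ≤ (Complex.exp (-(x * z))).re := by
      rw [Complex.exp_re]
      refine mul_nonneg (Real.exp_pos _).le (Real.cos_nonneg_of_mem_Icc ?_)
      have h2 : |(-((x : ℂ) * z)).im| ≤ 1 := by
        simp only [Complex.neg_im, Complex.mul_im, Complex.ofReal_re, Complex.ofReal_im, zero_mul,
          add_zero, abs_neg, abs_mul, abs_of_nonneg hx]
        exact (mul_le_mul_of_nonneg_left hz hx).trans h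
      rw [abs_le] at h2
      constructor <;> linarith [Real.pi_gt_three]
    simp only [Complex.add_re, Complex.one_re]
    linarith
  · have h1 : Real.exp (-(x * z.re)) ≤ 1 / 2 := by
      have h2 : Real.exp (-(x * z.re)) ≤ Real.exp (-1) := Real.exp_le_exp.2 (by linarith)
      have h3 : Real.exp (-1) ≤ 1 / 2 := by
        rw [Real.exp_neg, ← one_div]
        exact one_div_le_one_div_of_le two_pos (by linarith [Real.add_one_le_exp 1])
      linarith
    have h2 := Complex.abs_re_le_norm (Complex.exp (-(x * z)))
    rw [hE, abs_le] at h2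
    simp only [Complex.add_re, Complex.one_re]
    linarith [h2.1]

theorem half_le_norm_one_add_exp (hz : |z.im| ≤ z.re) {x : ℝ} (hx : 0 ≤ x) :
    1 / 2 ≤ ‖1 + Complex.exp (-(x * z))‖ :=
  (half_le_re_one_add_exp hz hx).trans (Complex.re_le_norm _)

theorem hasDerivAt_exp_neg_mul (z : ℂ) (x : ℝ) :
    HasDerivAt (fun y : ℝ => 1 + Complex.exp (-(y * z))) (-z * Complex.exp (-(x * z))) x := by
  have h1 : HasDerivAt (fun y : ℝ => -((y : ℂ) * z)) (-(((1 : ℝ) : ℂ) * z)) x :=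
    ((hasDerivAt_id x).ofReal_comp.mul_const z).neg
  have h2 := (h1.cexp).const_add 1
  convert! h2 using 1
  push_cast
  ring

theorem hasDerivAt_log_one_add_exp (hz : |z.im| ≤ z.re) {x : ℝ} (hx : 0 ≤ x) :
    HasDerivAt (fun y : ℝ => Complex.log (1 + Complex.exp (-(y * z))))
      (-z * Complex.exp (-(x * z)) / (1 + Complex.exp (-(x * z)))) x :=
  (hasDerivAt_exp_neg_mul z x).clog_real
    (Or.inl (lt_of_lt_of_le (by norm_num) (half_le_re_one_add_exp hz hx)))

theorem hasDerivAt_deriv_log_one_add_exp (hz : |z.im| ≤ z.re) {x : ℝ} (hx : 0 ≤ x) :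
    HasDerivAt (fun y : ℝ => -z * Complex.exp (-(y * z)) / (1 + Complex.exp (-(y * z))))
      (z ^ 2 * Complex.exp (-(x * z)) / (1 + Complex.exp (-(x * z))) ^ 2) x := by
  have hne : 1 + Complex.exp (-(x * z)) ≠ 0 :=
    norm_pos_iff.1 (lt_of_lt_of_le (by norm_num) (half_le_norm_one_add_exp hz hx))
  have h1 := hasDerivAt_exp_neg_mul z x
  have h2 : HasDerivAt (fun y : ℝ => -z * Complex.exp (-(y * z)))
      (-z * (-z * Complex.exp (-(x * z)))) x := by
    have := (h1.sub_const 1).const_mul (-z)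
    simpa using this
  convert! h2.div h1 hne using 1
  congr 1
  ring

theorem norm_second_deriv_log_one_add_exp_le (hz : |z.im| ≤ z.re) {x : ℝ} (hx : 0 ≤ x) :
    ‖z ^ 2 * Complex.exp (-(x * z)) / (1 + Complex.exp (-(x * z))) ^ 2‖ ≤
      8 * z.re ^ 2 * Real.exp (-(x * z.re)) := by
  have hE : ‖Complex.exp (-(x * z))‖ = Real.exp (-(x * z.re)) := by
    rw [Complex.norm_exp]; simp
  have h1 := half_le_norm_one_add_exp hz hx
  have h2 : ‖z‖ ^ 2 ≤ 2 * z.re ^ 2 := by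
    rw [Complex.sq_norm, Complex.normSq_apply]
    nlinarith [sq_abs z.im, abs_nonneg z.im]
  have h3 : 1 / 4 ≤ ‖1 + Complex.exp (-(x * z))‖ ^ 2 := by nlinarith
  rw [norm_div, norm_mul, norm_pow, norm_pow, hE, div_le_iff₀ (by linarith)]
  have hpos := Real.exp_pos (-(x * z.re))
  have h5 := mul_le_mul_of_nonneg_right h2 hpos.le
  have h6 := mul_le_mul_of_nonneg_left h3
    (show 0 ≤ 8 * z.re ^ 2 * Real.exp (-(x * z.re)) by positivity)
  linarith

theorem integrableOn_log_one_add_exp (hz : |z.im| ≤ z.re) (hz0 : 0 < z.re) :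
    IntegrableOn (fun x : ℝ => Complex.log (1 + Complex.exp (-(x * z)))) (Set.Ioi 0) := by
  have hcont : ContinuousOn (fun x : ℝ => Complex.log (1 + Complex.exp (-(x * z)))) (Set.Ici 0) :=
    fun x hx => (hasDerivAt_log_one_add_exp hz hx).continuousAt.continuousWithinAt
  have h1 : IntegrableOn (fun x : ℝ => ‖Complex.log (1 + Complex.exp (-(x * z)))‖) (Set.Ioi 0) := by
    refine integrable_of_isBigO_exp_neg hz0 hcont.norm ?_
    refine Asymptotics.IsBigO.of_bound (3 / 2) ?_
    have h2 : ∀ᶠ x : ℝ in atTop, 1 ≤ x * z.re :=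
      (tendsto_id.atTop_mul_const hz0).eventually_ge_atTop 1
    filter_upwards [h2] with x hx
    have hE : ‖Complex.exp (-(x * z))‖ = Real.exp (-(x * z.re)) := by
      rw [Complex.norm_exp]; simp
    have hE2 : ‖Complex.exp (-(x * z))‖ ≤ 1 / 2 := by
      rw [hE]
      have h2 : Real.exp (-(x * z.re)) ≤ Real.exp (-1) := Real.exp_le_exp.2 (by linarith)
      have h3 : Real.exp (-1) ≤ 1 / 2 := by
        rw [Real.exp_neg, ← one_div]
        exact one_div_le_one_div_of_le two_pos (by linarith [Real.add_one_le_exp 1])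
      linarith
    have := Complex.norm_log_one_add_half_le_self hE2
    rw [norm_norm, Real.norm_of_nonneg (Real.exp_pos _).le]
    rw [hE] at this
    convert this using 3
    ring
  exact (integrable_norm_iff ((hcont.mono Set.Ioi_subset_Ici_self).aestronglyMeasurable
    measurableSet_Ioi)).1 h1

/-- Termwise integration of the logarithm series reduces this to the alternating sum of inverse
squares. -/
theorem integral_log_one_add_exp (hz0 : 0 < z.re) :
    ∫ x in Set.Ioi (0 : ℝ), Complex.log (1 + Complex.exp (-(x * z))) = Real.pi ^ 2 / (12 * z) := by
  have hz : z ≠ 0 := fun h => by simp [h] at hz0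
  set F : ℕ → ℝ → ℂ := fun n x => (-1) ^ (n + 1) / n * Complex.exp ((-(n * z)) * x) with hF
  have hFint : ∀ n, IntegrableOn (F n) (Set.Ioi 0) := fun n => by
    rcases Nat.eq_zero_or_pos n with rfl | hn
    · simp [hF]
    · refine (integrableOn_exp_mul_complex_Ioi ?_ 0).const_mul _
      have : (0 : ℝ) < n := by exact_mod_cast hn
      simpa using mul_pos this hz0
  have hnorm : ∀ n, ∫ x in Set.Ioi (0 : ℝ), ‖F n x‖ = 1 / (n : ℝ) ^ 2 * (1 / z.re) := fun n => by
    rcases Nat.eq_zero_or_pos n with rfl | hn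
    · simp [hF]
    · have hn' : (0 : ℝ) < n := by exact_mod_cast hn
      have e : ∀ x : ℝ, ‖F n x‖ = 1 / n * Real.exp (-(n * z.re) * x) := fun x => by
        simp [hF, Complex.norm_exp]
      simp only [e]
      rw [integral_const_mul, integral_exp_mul_Ioi (by nlinarith)]
      simp
      field_simp
  have hsum := hasSum_integral_of_summable_integral_norm hFint (by
    simp only [hnorm]
    exact (Real.summable_one_div_nat_pow.2 one_lt_two).mul_right _)
  have hint : ∀ n, ∫ x in Set.Ioi (0 : ℝ), F n x =
      (((-1 : ℝ) ^ (n + 1) / (n : ℝ) ^ 2 : ℝ) : ℂ) * (1 / z) := fun n => by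
    rcases Nat.eq_zero_or_pos n with rfl | hn
    · simp [hF]
    · have hn' : (0 : ℝ) < n := by exact_mod_cast hn
      have hn0 : (n : ℂ) ≠ 0 := by exact_mod_cast hn.ne'
      simp only [hF]
      rw [integral_const_mul, integral_exp_mul_complex_Ioi (by simpa using mul_pos hn' hz0)]
      push_cast
      simp
      field_simp
  simp only [hint] at hsum
  have h1 := ((Complex.hasSum_ofReal.2 hasSum_alternating_inv_sq).mul_right (1 / z)).unique hsum
  rw [setIntegral_congr_fun measurableSet_Ioi (g := fun x => ∑' n, F n x), ← h1]
  · push_cast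
    field_simp
  · intro x hx
    have hlt : ‖Complex.exp (-(x * z))‖ < 1 := by
      rw [Complex.norm_exp]
      simpa using mul_pos hx hz0
    dsimp only
    rw [← (Complex.hasSum_taylorSeries_log hlt).tsum_eq]
    refine tsum_congr fun n => ?_
    rw [hF, ← Complex.exp_nat_mul]
    have : (n : ℂ) * -(x * z) = -(n * z) * x := by ring
    rw [this]
    ring

/-- Trapezoid rule on unit cells. The integral gives `π² / (12 z)`, and `-log 2 / 2` is the half
weight of the endpoint 0, absent from the sum. The cell errors decay geometrically and add up to `12
r² · (2 / r)` with `r = Re z`. -/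
theorem norm_tsum_log_one_add_exp_sub_le (hz : |z.im| ≤ z.re) (hz0 : 0 < z.re) (hz1 : z.re ≤ 1) :
    ‖(∑' k : ℕ, Complex.log (1 + Complex.exp (-((k + 1 : ℕ) * z)))) -
      (Real.pi ^ 2 / (12 * z) - Complex.log 2 / 2)‖ ≤ 24 * z.re := by
  set g : ℝ → ℂ := fun x => Complex.log (1 + Complex.exp (-(x * z))) with hg
  have hd := fun (x : ℝ) (hx : 0 ≤ x) => hasDerivAt_log_one_add_exp hz hx
  have hcell : ∀ k : ℕ, ‖(∫ x in (k : ℝ)..((k + 1 : ℕ) : ℝ), g x) - (g k + g (k + 1 : ℕ)) / 2‖ ≤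
      12 * z.re ^ 2 * Real.exp (-z.re) ^ k := fun k => by
    have hk : (0 : ℝ) ≤ k := k.cast_nonneg
    have := norm_integral_sub_trapezoid_le (a := k) (M := 8 * z.re ^ 2 * Real.exp (-(k * z.re)))
      (fun x hx => hd x (hk.trans hx.1))
      (fun x hx => hasDerivAt_deriv_log_one_add_exp hz (hk.trans hx.1))
      (fun x hx => (norm_second_deriv_log_one_add_exp_le hz (hk.trans hx.1)).trans (by
        have := hx.1
        gcongr))
    push_cast
    refine this.trans (le_of_eq ?_)
    rw [← Real.exp_nat_mul, mul_neg]
    ring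
  have hpart : ∀ N : ℕ, ‖(∫ x in (0 : ℝ)..(N : ℝ), g x) -
      ((∑ k ∈ Finset.range N, g (k + 1 : ℕ)) + g 0 / 2 - g N / 2)‖ ≤ 24 * z.re := fun N => by
    have h1 := intervalIntegral.sum_integral_adjacent_intervals (f := g) (μ := volume)
      (a := fun k : ℕ => (k : ℝ)) (n := N) fun k _ => by
        apply ContinuousOn.intervalIntegrable
        intro x hx
        rw [Set.uIcc_of_le (by simp)] at hx
        exact (hd x ((Nat.cast_nonneg k).trans hx.1)).continuousAt.continuousWithinAt
    have h2 : ∀ N : ℕ, ∑ k ∈ Finset.range N, (g k + g (k + 1 : ℕ)) / 2 =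
        (∑ k ∈ Finset.range N, g (k + 1 : ℕ)) + g 0 / 2 - g N / 2 := fun N => by
      induction N with
      | zero => simp
      | succ N ih => rw [Finset.sum_range_succ, ih, Finset.sum_range_succ]; ring
    have h3 := norm_sum_le_of_le (Finset.range N) fun k _ => hcell k
    rw [Finset.sum_sub_distrib, h2, h1, ← Finset.mul_sum] at h3
    rw [Nat.cast_zero] at h3
    refine h3.trans ?_
    have hr1 : Real.exp (-z.re) < 1 := by simpa using hz0
    have h4 : ∑ k ∈ Finset.range N, Real.exp (-z.re) ^ k ≤ (1 - Real.exp (-z.re))⁻¹ := by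
      rw [← tsum_geometric_of_lt_one (Real.exp_pos _).le hr1]
      exact (summable_geometric_of_lt_one (Real.exp_pos _).le hr1).sum_le_tsum _
        fun k _ => by positivity
    have h5 : z.re / 2 ≤ 1 - Real.exp (-z.re) := by
      have h6 := Real.add_one_le_exp z.re
      have h7 : Real.exp (-z.re) ≤ 1 / (1 + z.re) := by
        rw [Real.exp_neg, ← one_div]
        exact one_div_le_one_div_of_le (by linarith) (by linarith)
      have h8 : 1 / (1 + z.re) ≤ 1 - z.re / 2 := by
        rw [div_le_iff₀ (by linarith)]
        nlinarith
      linarith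
    have h6 : (1 - Real.exp (-z.re))⁻¹ ≤ 2 / z.re := by
      rw [← one_div, div_le_div_iff₀ (by linarith) hz0]
      linarith
    calc 12 * z.re ^ 2 * ∑ k ∈ Finset.range N, Real.exp (-z.re) ^ k
        ≤ 12 * z.re ^ 2 * (2 / z.re) := by gcongr; exact h4.trans h6
      _ = 24 * z.re := by field_simp; norm_num
  have hsum := (summable_log_one_add_exp hz0).hasSum.tendsto_sum_nat
  have hint := intervalIntegral_tendsto_integral_Ioi 0 (integrableOn_log_one_add_exp hz hz0)
    (tendsto_natCast_atTop_atTop (R := ℝ))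
  have hgN : Tendsto (fun N : ℕ => g N) atTop (𝓝 0) := by
    rw [← tendsto_add_atTop_iff_nat 1]
    exact (summable_log_one_add_exp hz0).tendsto_atTop_zero
  have hlim := (hint.sub ((hsum.add_const (g 0 / 2)).sub (hgN.div_const 2))).norm
  have hle := le_of_tendsto hlim (Eventually.of_forall hpart)
  rw [integral_log_one_add_exp hz0] at hle
  have hg0 : g 0 = Complex.log 2 := by
    simp only [hg, Complex.ofReal_zero, zero_mul, neg_zero, Complex.exp_zero]
    norm_num
  rw [← norm_neg, hg0] at hle
  convert! hle using 2
  ring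

end Cone

theorem logSum_eq_sub {m : ℕ} (hm : 0 < m) {z : ℂ} (hz : 0 < z.re) :
    logSum m z = (∑' k : ℕ, Complex.log (1 + Complex.exp (-((k + 1 : ℕ) * z)))) -
      ∑' k : ℕ, Complex.log (1 + Complex.exp (-((k + 1 : ℕ) * (m * z)))) := by
  set f : ℕ → ℂ := fun k => Complex.log (1 + Complex.exp (-((k + 1 : ℕ) * z))) with hf
  have hinj : Function.Injective (fun k : ℕ => m * (k + 1) - 1) := by
    intro a b hab
    have ha : 0 < m * (a + 1) := by positivity
    have hb : 0 < m * (b + 1) := by positivity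
    have : m * (a + 1) = m * (b + 1) := by
      dsimp only at hab; omega
    simpa using Nat.eq_of_mul_eq_mul_left hm this
  have h1 : ∑' k : ℕ, Complex.log (1 + Complex.exp (-((k + 1 : ℕ) * (m * z)))) =
      ∑' k : ℕ, if m ∣ k + 1 then f k else 0 := by
    rw [← hinj.tsum_eq (f := fun k => if m ∣ k + 1 then f k else 0)]
    · refine tsum_congr fun k => ?_
      have ha : 0 < m * (k + 1) := by positivity
      have : m * (k + 1) - 1 + 1 = m * (k + 1) := by omega
      simp only [this, dvd_mul_right, if_true, hf]
      congr 4
      push_cast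
      ring
    · intro k hk
      have hdvd : m ∣ k + 1 := by
        by_contra hcon
        simp [hcon] at hk
      obtain ⟨j, hj⟩ := hdvd
      have hj0 : j ≠ 0 := by rintro rfl; simp at hj
      refine ⟨j - 1, ?_⟩
      have : j - 1 + 1 = j := by omega
      simp only [this, ← hj]
      omega
  have hs1 := summable_logSum m hz
  have hs2 : Summable fun k => if m ∣ k + 1 then f k else 0 := by
    refine Summable.of_norm_bounded (summable_log_one_add_exp hz).norm fun k => ?_
    split_ifs <;> simp [hf]
  rw [eq_sub_iff_add_eq, h1, logSum, ← hs1.tsum_add hs2]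
  refine tsum_congr fun k => ?_
  split_ifs <;> simp [hf]

/-- The previous expansion is applied at `z` and at `m z`; the two `log 2 / 2` terms cancel, so no
constant term remains. -/
theorem norm_logSum_sub_le {m : ℕ} (hm : 0 < m) {z : ℂ} (hz : |z.im| ≤ z.re) (hz0 : 0 < z.re)
    (hz1 : m * z.re ≤ 1) :
    ‖logSum m z - ((Real.pi ^ 2 * (m - 1) / (12 * m) : ℝ) : ℂ) / z‖ ≤ 24 * (1 + m) * z.re := by
  have hm1 : (1 : ℝ) ≤ m := by exact_mod_cast hm
  have hmc : (m : ℂ) ≠ 0 := by exact_mod_cast hm.ne'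
  have hzne : z ≠ 0 := fun h => by simp [h] at hz0
  have hre : ((m : ℂ) * z).re = m * z.re := by simp
  have him : ((m : ℂ) * z).im = m * z.im := by simp
  have h1 := norm_tsum_log_one_add_exp_sub_le hz hz0 (by nlinarith)
  have h2 := norm_tsum_log_one_add_exp_sub_le (z := m * z)
    (by rw [hre, him, abs_mul, Nat.abs_cast]; gcongr) (by rw [hre]; positivity) (by rwa [hre])
  rw [hre] at h2
  rw [logSum_eq_sub hm hz0]
  have e : ((Real.pi ^ 2 * (m - 1) / (12 * m) : ℝ) : ℂ) / z =
      (Real.pi ^ 2 / (12 * z) - Complex.log 2 / 2) -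
        (Real.pi ^ 2 / (12 * (m * z)) - Complex.log 2 / 2) := by
    push_cast
    field_simp
    ring
  rw [e, sub_sub_sub_comm]
  refine (norm_sub_le _ _).trans ?_
  linarith

/-! ### The saddle point limit. -/

/-- The saddle point integrand on the circle of radius `exp (-τ ^ 2)`, in the rescaled angle
`u = θ / τ ^ 3` and normalised by its value `exp (2 A / τ ^ 2)` at the saddle point. -/
noncomputable def saddleIntegrand (m h : ℕ) (A τ : ℝ) : ℝ → ℂ :=
  (Set.Ioc (-(Real.pi / τ ^ 3)) (Real.pi / τ ^ 3)).indicator fun u =>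
    Complex.exp (h * logSum m ((τ ^ 2 : ℝ) - (τ ^ 3 * u : ℝ) * Complex.I)) *
      Complex.exp ((A / τ ^ 4 : ℝ) * ((τ ^ 2 : ℝ) - (τ ^ 3 * u : ℝ) * Complex.I) -
        (2 * A / τ ^ 2 : ℝ))

theorem measurable_logSum_line (m : ℕ) {t : ℝ} (ht : 0 < t) (c : ℝ) :
    Measurable fun u : ℝ => logSum m (t - (c * u : ℝ) * Complex.I) := by
  refine measurable_of_tendsto_metrizable (f := fun (N : ℕ) (u : ℝ) =>
    ∑ k ∈ Finset.range N, if m ∣ k + 1 then 0 else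
      Complex.log (1 + Complex.exp (-((k + 1 : ℕ) * (t - (c * u : ℝ) * Complex.I)))))
    (fun N => ?_) ?_
  · refine Finset.measurable_sum _ fun k _ => ?_
    by_cases hk : m ∣ k + 1
    · simp [hk]
    · simp only [hk, if_false]
      refine Measurable.clog (Continuous.measurable ?_)
      fun_prop
  · rw [tendsto_pi_nhds]
    intro u
    exact (summable_logSum m (by simpa using ht)).hasSum.tendsto_sum_nat

theorem measurable_saddleIntegrand (m h : ℕ) (A : ℝ) {τ : ℝ} (hτ : 0 < τ) :
    Measurable (saddleIntegrand m h A τ) := by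
  refine Measurable.indicator ?_ measurableSet_Ioc
  refine Measurable.mul ?_ (Continuous.measurable (by fun_prop))
  exact Complex.measurable_exp.comp
    ((measurable_logSum_line m (pow_pos hτ 2) (τ ^ 3)).const_mul _)

theorem coeff_qProductPow_eq_integral_saddleIntegrand {m : ℕ} (hm : 0 < m) (h n : ℕ) {A τ : ℝ}
    (hτ : 0 < τ) (hn : (n : ℝ) = A / τ ^ 4) :
    PowerSeries.coeff n (qProductPow m h) * (2 * Real.pi) =
      τ ^ 3 * Real.exp (2 * A / τ ^ 2) * (∫ u, saddleIntegrand m h A τ u).re := by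
  have hτ3 : 0 < τ ^ 3 := pow_pos hτ 3
  have h1 := coeff_qProductPow_eq_integral hm h n (pow_pos hτ 2)
  have h2 := intervalIntegral.smul_integral_comp_mul_left (a := -(Real.pi / τ ^ 3))
    (b := Real.pi / τ ^ 3) (fun θ : ℝ => Complex.exp (h * logSum m ((τ ^ 2 : ℝ) - θ * Complex.I)) *
        Complex.exp (n * ((τ ^ 2 : ℝ) - θ * Complex.I))) (τ ^ 3)
  have e1 : τ ^ 3 * -(Real.pi / τ ^ 3) = -Real.pi := by field_simp
  have e2 : τ ^ 3 * (Real.pi / τ ^ 3) = Real.pi := by field_simp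
  rw [e1, e2, ← h1] at h2
  have h3 : (∫ u in (-(Real.pi / τ ^ 3))..(Real.pi / τ ^ 3),
      Complex.exp (h * logSum m ((τ ^ 2 : ℝ) - (τ ^ 3 * u : ℝ) * Complex.I)) *
        Complex.exp (n * ((τ ^ 2 : ℝ) - (τ ^ 3 * u : ℝ) * Complex.I))) =
      (Real.exp (2 * A / τ ^ 2) : ℝ) * ∫ u, saddleIntegrand m h A τ u := by
    have hpos : 0 ≤ Real.pi / τ ^ 3 := by positivity
    simp only [saddleIntegrand]
    rw [integral_indicator measurableSet_Ioc, intervalIntegral.integral_of_le (by linarith),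
      ← integral_const_mul]
    refine integral_congr_ae (Eventually.of_forall fun u => ?_)
    dsimp only
    rw [Complex.exp_sub, ← hn, Complex.ofReal_exp]
    have := Complex.exp_ne_zero ((2 * A / τ ^ 2 : ℝ) : ℂ)
    rw [Complex.ofReal_natCast]
    field_simp
  rw [h3] at h2
  have h4 := congrArg Complex.re h2
  rw [Complex.smul_re, Complex.re_ofReal_mul] at h4
  have h5 : (((PowerSeries.coeff n (qProductPow m h) : ℝ) : ℂ) * (2 * Real.pi)).re =
      PowerSeries.coeff n (qProductPow m h) * (2 * Real.pi) := by
    rw [Complex.re_ofReal_mul]; simp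
  rw [← h5, ← h4, smul_eq_mul, mul_assoc]

theorem exists_norm_saddleIntegrand_le {m : ℕ} (hm : 1 < m) {h : ℕ} (hh : 1 ≤ h) {A : ℝ}
    (hA : A = h * (Real.pi ^ 2 * (m - 1) / (12 * m))) : ∃ C : ℝ, ∀ τ u : ℝ, 0 < τ → m * τ ^ 2 ≤ 1 →
    ‖saddleIntegrand m h A τ u‖ ≤ C * (1 + u ^ 2)⁻¹ := by
  obtain ⟨c, hc, hdef⟩ := exists_le_cosDefect hm
  have hh1 : (1 : ℝ) ≤ h := by exact_mod_cast hh
  have hm1 : (1 : ℝ) ≤ m := by exact_mod_cast hm.le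
  set K : ℝ := 384 * (1 + Real.pi ^ 2) / c ^ 3 + (1 + 4 / c) with hK
  have hK0 : 0 ≤ K := by positivity
  refine ⟨Real.exp (h * (24 * (1 + m))) * K, fun τ u hτ hτ1 => ?_⟩
  have ht : 0 < τ ^ 2 := pow_pos hτ 2
  have hτ2 : τ ^ 2 ≤ 1 := by nlinarith
  by_cases hu : u ∈ Set.Ioc (-(Real.pi / τ ^ 3)) (Real.pi / τ ^ 3)
  swap
  · rw [saddleIntegrand, Set.indicator_of_notMem hu, norm_zero]
    positivity
  have hθ : |τ ^ 3 * u| ≤ Real.pi := by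
    have h1 : |u| ≤ Real.pi / τ ^ 3 := abs_le.2 ⟨hu.1.le, hu.2⟩
    rw [abs_mul, abs_of_pos (pow_pos hτ 3), mul_comm]
    rwa [le_div_iff₀ (pow_pos hτ 3)] at h1
  rw [saddleIntegrand, Set.indicator_of_mem hu, norm_mul, Complex.norm_exp, Complex.norm_exp,
    ← Real.exp_add]
  have hre1 : ((h : ℂ) * logSum m ((τ ^ 2 : ℝ) - (τ ^ 3 * u : ℝ) * Complex.I)).re =
      h * (logSum m ((τ ^ 2 : ℝ) - (τ ^ 3 * u : ℝ) * Complex.I)).re := by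
    rw [← Complex.ofReal_natCast, Complex.re_ofReal_mul]
  have hre2 : (((A / τ ^ 4 : ℝ) : ℂ) * ((τ ^ 2 : ℝ) - (τ ^ 3 * u : ℝ) * Complex.I) -
        (2 * A / τ ^ 2 : ℝ)).re = -(A / τ ^ 2) := by
    rw [Complex.sub_re, Complex.re_ofReal_mul, Complex.ofReal_re]
    simp only [Complex.sub_re, Complex.ofReal_re, Complex.mul_re, Complex.ofReal_im, Complex.I_re,
      Complex.I_im, mul_zero, mul_one, sub_zero]
    field_simp
    ring
  rw [hre1, hre2]
  have h1 := re_logSum_le m ht (τ ^ 3 * u)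
  have h2 : (logSum m ((τ ^ 2 : ℝ) : ℂ)).re ≤
      Real.pi ^ 2 * (m - 1) / (12 * m) / τ ^ 2 + 24 * (1 + m) := by
    have h3 := norm_logSum_sub_le (z := ((τ ^ 2 : ℝ) : ℂ)) (by omega : 0 < m)
      (by rw [Complex.ofReal_im, Complex.ofReal_re]; simpa using ht.le)
      (by rw [Complex.ofReal_re]; exact ht) (by rw [Complex.ofReal_re]; exact hτ1)
    have h4 := (Complex.re_le_norm _).trans h3
    rw [← Complex.ofReal_div, Complex.sub_re, Complex.ofReal_re, Complex.ofReal_re] at h4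
    nlinarith
  set S := cosDefect m (τ ^ 2) (τ ^ 3 * u) with hS
  have hS0 : 0 ≤ S := tsum_nonneg fun k => cosDefect_term_nonneg m k _ _
  have h3 : h * (logSum m ((τ ^ 2 : ℝ) - (τ ^ 3 * u : ℝ) * Complex.I)).re + -(A / τ ^ 2) ≤
      h * (24 * (1 + m)) + -(S / 4) := by
    have h4 : (logSum m ((τ ^ 2 : ℝ) - (τ ^ 3 * u : ℝ) * Complex.I)).re ≤
        Real.pi ^ 2 * (m - 1) / (12 * m) / τ ^ 2 + 24 * (1 + m) - S / 4 := by linarith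
    have h5 := mul_le_mul_of_nonneg_left h4 (by linarith : (0 : ℝ) ≤ h)
    have h6 : A / τ ^ 2 = h * (Real.pi ^ 2 * (m - 1) / (12 * m) / τ ^ 2) := by rw [hA]; ring
    have h7 : S / 4 ≤ h * (S / 4) := le_mul_of_one_le_left (by positivity) hh1
    rw [h6]
    linarith
  refine (Real.exp_le_exp.2 h3).trans ?_
  rw [Real.exp_add, mul_assoc]
  refine mul_le_mul_of_nonneg_left ?_ (Real.exp_pos _).le
  rw [← div_eq_mul_inv, le_div_iff₀ (by positivity)]
  rcases hdef (τ ^ 2) (τ ^ 3 * u) ht hτ2 hθ with h4 | h4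
  · have h5 : Real.exp (-(S / 4)) ≤ Real.exp (-(c / τ ^ 2 / 4)) := Real.exp_le_exp.2 (by linarith)
    -- The cubic term of the exponential gives a factor `τ ^ 6`, which absorbs `1 + u²` since `|u| ≤
    -- π / τ³`; the constant is `384 = 3! · 4³`.
    have h6 := Real.pow_div_factorial_le_exp (c / τ ^ 2 / 4) (by positivity) 3
    have h7 : Real.exp (-(c / τ ^ 2 / 4)) ≤ 384 * τ ^ 6 / c ^ 3 := by
      rw [Real.exp_neg]
      refine (inv_anti₀ (by positivity) h6).trans (le_of_eq ?_)
      simp [Nat.factorial]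
      field_simp
      norm_num
    have h8 : τ ^ 6 * (1 + u ^ 2) ≤ 1 + Real.pi ^ 2 := by
      have h9 : (τ ^ 3 * u) ^ 2 ≤ Real.pi ^ 2 := by
        rw [← sq_abs]
        exact pow_le_pow_left₀ (abs_nonneg _) hθ 2
      have h10 : (τ ^ 2) ^ 3 ≤ 1 := pow_le_one₀ ht.le hτ2
      nlinarith
    calc Real.exp (-(S / 4)) * (1 + u ^ 2) ≤ 384 * τ ^ 6 / c ^ 3 * (1 + u ^ 2) := by
          gcongr
          exact h5.trans h7
      _ = 384 * (τ ^ 6 * (1 + u ^ 2)) / c ^ 3 := by ring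
      _ ≤ 384 * (1 + Real.pi ^ 2) / c ^ 3 := by gcongr
      _ ≤ K := by rw [hK]; linarith [show 0 < 1 + 4 / c by positivity]
  · have h5 : c * (τ ^ 3 * u) ^ 2 / (τ ^ 2) ^ 3 = c * u ^ 2 := by field_simp
    rw [h5] at h4
    have h6 : Real.exp (-(S / 4)) ≤ (1 + c * u ^ 2 / 4)⁻¹ := by
      rw [Real.exp_neg]
      apply inv_anti₀ (by positivity)
      linarith [Real.add_one_le_exp (S / 4)]
    calc Real.exp (-(S / 4)) * (1 + u ^ 2) ≤ (1 + c * u ^ 2 / 4)⁻¹ * (1 + u ^ 2) := by gcongr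
      _ ≤ 1 + 4 / c := by
        rw [inv_mul_le_iff₀ (by positivity)]
        have : (1 + c * u ^ 2 / 4) * (1 + 4 / c) = 1 + u ^ 2 + c * u ^ 2 / 4 + 4 / c := by
          field_simp
          ring
        rw [this]
        have h8 : 0 ≤ c * u ^ 2 / 4 := by positivity
        have h9 : 0 ≤ 4 / c := by positivity
        linarith
      _ ≤ K := by rw [hK]; linarith [show 0 < 384 * (1 + Real.pi ^ 2) / c ^ 3 by positivity]

/-- For fixed `u` the point `z = τ² D`, `D = 1 - i τ u`, eventually enters the cone. No Taylor
expansion is needed: `A / z + A z / τ⁴ - 2 A / τ² = (A / τ²) (D - 1)² / D = -A u² / D` exactly, and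
`D → 1`. -/
theorem tendsto_saddleIntegrand {m : ℕ} (hm : 1 < m) (h : ℕ) {A : ℝ}
    (hA : A = h * (Real.pi ^ 2 * (m - 1) / (12 * m))) (u : ℝ) :
    Tendsto (fun τ : ℝ => saddleIntegrand m h A τ u) (𝓝[>] 0)
      (𝓝 ((Real.exp (-A * u ^ 2) : ℝ) : ℂ)) := by
  have hm1 : (1 : ℝ) ≤ m := by exact_mod_cast hm.le
  set B : ℝ := Real.pi ^ 2 * (m - 1) / (12 * m) with hB
  set z : ℝ → ℂ := fun τ => (τ ^ 2 : ℝ) - (τ ^ 3 * u : ℝ) * Complex.I with hz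
  have hzre : ∀ τ, (z τ).re = τ ^ 2 := fun τ => by
    simp only [hz, Complex.sub_re, Complex.ofReal_re, Complex.mul_re, Complex.ofReal_im,
      Complex.I_re, Complex.I_im, mul_zero, mul_one, sub_zero]
  have hzim : ∀ τ, (z τ).im = -(τ ^ 3 * u) := fun τ => by
    simp only [hz, Complex.sub_im, Complex.ofReal_im, Complex.mul_im, Complex.ofReal_re,
      Complex.I_re, Complex.I_im, mul_zero, mul_one, zero_sub, add_zero]
  have hpos : ∀ᶠ τ : ℝ in 𝓝[>] 0, 0 < τ := self_mem_nhdsWithin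
  have hcontract : ∀ (f : ℝ → ℝ), Continuous f → f 0 = 0 → ∀ᶠ τ : ℝ in 𝓝[>] 0, f τ < 1 :=
    fun f hf h0 => by
      have : Tendsto f (𝓝[>] 0) (𝓝 0) := by
        have := (hf.tendsto 0).mono_left (nhdsWithin_le_nhds (s := Set.Ioi 0))
        rwa [h0] at this
      exact this.eventually_lt_const one_pos
  have hcone := hcontract (fun τ => τ * |u|) (by fun_prop) (by simp)
  have hsmall := hcontract (fun τ => m * τ ^ 2) (by fun_prop) (by simp)
  have hone := hcontract (fun τ => τ) (by fun_prop) rfl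
  have herr : Tendsto (fun τ => (h : ℂ) * (logSum m (z τ) - (B : ℂ) / z τ)) (𝓝[>] 0) (𝓝 0) := by
    rw [← mul_zero (h : ℂ)]
    refine Tendsto.const_mul _ ?_
    have hto : Tendsto (fun τ : ℝ => 24 * (1 + m) * τ ^ 2) (𝓝[>] 0) (𝓝 0) := by
      have hc : Continuous fun τ : ℝ => 24 * (1 + (m : ℝ)) * τ ^ 2 := by fun_prop
      have := (hc.tendsto 0).mono_left (nhdsWithin_le_nhds (s := Set.Ioi 0))
      simpa using this
    refine squeeze_zero_norm' ?_ hto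
    filter_upwards [hpos, hcone, hsmall] with τ h1 h2 h3
    have := norm_logSum_sub_le (z := z τ) (by omega : 0 < m)
      (by
        rw [hzre, hzim, abs_neg, abs_mul, abs_of_pos (pow_pos h1 3)]
        calc τ ^ 3 * |u| = τ ^ 2 * (τ * |u|) := by ring
          _ ≤ τ ^ 2 * 1 := by gcongr
          _ = τ ^ 2 := mul_one _)
      (by rw [hzre]; positivity) (by rw [hzre]; exact h3.le)
    rwa [hzre] at this
  have hmain : Tendsto (fun τ : ℝ => -(A * u ^ 2 : ℂ) / (1 - (τ * u : ℝ) * Complex.I)) (𝓝[>] 0)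
      (𝓝 (-(A * u ^ 2 : ℂ))) := by
    have hc : Tendsto (fun τ : ℝ => (1 - (τ * u : ℝ) * Complex.I : ℂ)) (𝓝[>] 0) (𝓝 1) := by
      have hc : Continuous fun τ : ℝ => (1 - (τ * u : ℝ) * Complex.I : ℂ) := by fun_prop
      have := (hc.tendsto 0).mono_left (nhdsWithin_le_nhds (s := Set.Ioi 0))
      simpa using this
    have := (tendsto_const_nhds (x := -(A * u ^ 2 : ℂ))).div hc one_ne_zero
    rwa [div_one] at this
  have hexp := (Complex.continuous_exp.tendsto _).comp (herr.add hmain)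
  have hlim : Complex.exp (0 + -(A * u ^ 2 : ℂ)) = ((Real.exp (-A * u ^ 2) : ℝ) : ℂ) := by
    push_cast
    congr 1
    ring
  rw [hlim] at hexp
  refine hexp.congr' ?_
  have hmem : ∀ᶠ τ : ℝ in 𝓝[>] 0, u ∈ Set.Ioc (-(Real.pi / τ ^ 3)) (Real.pi / τ ^ 3) := by
    filter_upwards [hpos, hone, hcone] with τ h1 h2 h3
    have h4 : |u| < Real.pi / τ ^ 3 := by
      rw [lt_div_iff₀ (pow_pos h1 3)]
      have h5 : τ ^ 2 ≤ 1 := pow_le_one₀ h1.le h2.le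
      have h6 : 0 ≤ τ * |u| := by positivity
      calc |u| * τ ^ 3 = τ * |u| * τ ^ 2 := by ring
        _ ≤ 1 * 1 := by gcongr
        _ < Real.pi := by linarith [Real.pi_gt_three]
    rw [abs_lt] at h4
    exact ⟨h4.1, h4.2.le⟩
  filter_upwards [hpos, hmem] with τ h1 h2
  rw [saddleIntegrand, Set.indicator_of_mem h2, ← Complex.exp_add, Function.comp_apply]
  congr 1
  have hτ : (τ : ℂ) ≠ 0 := by exact_mod_cast h1.ne'
  have hden : (1 - (τ * u : ℝ) * Complex.I : ℂ) ≠ 0 := fun h0 => by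
    have := congrArg Complex.re h0
    simp at this
  have hzτ : z τ = τ ^ 2 * (1 - (τ * u : ℝ) * Complex.I) := by
    simp only [hz]
    push_cast
    ring
  change (h : ℂ) * (logSum m (z τ) - (B : ℂ) / z τ) + _ = (h : ℂ) * logSum m (z τ) +
    ((A / τ ^ 4 : ℝ) * z τ - (2 * A / τ ^ 2 : ℝ))
  have hAB : (A : ℂ) = h * B := by rw [hA]; push_cast; rfl
  rw [mul_sub, hzτ]
  set D : ℂ := 1 - (τ * u : ℝ) * Complex.I with hD
  have hu2 : ((τ : ℂ) * u) ^ 2 = -(D - 1) ^ 2 := by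
    rw [hD]
    push_cast
    linear_combination ((τ : ℂ) ^ 2 * u ^ 2) * Complex.I_sq
  have key : -(A * (u : ℂ) ^ 2) / D = h * (B / (τ ^ 2 * D)) +
      (A / τ ^ 4 * (τ ^ 2 * D) - 2 * A / τ ^ 2) := by
    rw [← mul_div_assoc, ← hAB]
    field_simp
    linear_combination (-A : ℂ) * hu2
  push_cast
  rw [key]
  ring

theorem tendsto_integral_saddleIntegrand {m : ℕ} (hm : 1 < m) {h : ℕ} (hh : 1 ≤ h) {A : ℝ}
    (hA : A = h * (Real.pi ^ 2 * (m - 1) / (12 * m))) :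
    Tendsto (fun τ : ℝ => (∫ u, saddleIntegrand m h A τ u).re) (𝓝[>] 0)
      (𝓝 (√(Real.pi / A))) := by
  obtain ⟨C, hC⟩ := exists_norm_saddleIntegrand_le hm hh hA
  have hpos : ∀ᶠ τ : ℝ in 𝓝[>] 0, 0 < τ := self_mem_nhdsWithin
  have hsmall : ∀ᶠ τ : ℝ in 𝓝[>] 0, m * τ ^ 2 < 1 := by
    have hc : Continuous fun τ : ℝ => m * τ ^ 2 := by fun_prop
    have := (hc.tendsto 0).mono_left (nhdsWithin_le_nhds (s := Set.Ioi 0))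
    refine this.eventually_lt_const ?_
    simp
  have h1 := tendsto_integral_filter_of_dominated_convergence (μ := volume) (l := 𝓝[>] (0 : ℝ))
    (F := fun τ => saddleIntegrand m h A τ) (fun u => C * (1 + u ^ 2)⁻¹)
    (hpos.mono fun τ hτ => (measurable_saddleIntegrand m h A hτ).aestronglyMeasurable)
    (by
      filter_upwards [hpos, hsmall] with τ h1 h2
      exact Eventually.of_forall fun u => hC τ u h1 h2.le)
    (integrable_inv_one_add_sq.const_mul C)
    (Eventually.of_forall fun u => tendsto_saddleIntegrand hm h hA u)
  rw [integral_complex_ofReal, integral_gaussian] at h1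
  exact (Complex.continuous_re.tendsto _).comp h1

theorem isEquivalent_coeff_qProductPow {m : ℕ} (hm : 1 < m) {h : ℕ} (hh : 1 ≤ h) :
    Asymptotics.IsEquivalent atTop
      (fun n : ℕ => PowerSeries.coeff n (qProductPow m h))
      (fun n : ℕ =>
        ((h : ℝ) * ((m : ℝ) - 1) / (3 * (m : ℝ))) ^ (1 / 4 : ℝ)
            * Real.exp (Real.pi *
                Real.sqrt ((h : ℝ) * ((m : ℝ) - 1) * (n : ℝ) / (3 * (m : ℝ))))
          / ((2 : ℝ) ^ (3 / 2 : ℝ) * (n : ℝ) ^ (3 / 4 : ℝ))) := by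
  have hm1 : (1 : ℝ) < m := by exact_mod_cast hm
  have hh1 : (1 : ℝ) ≤ h := by exact_mod_cast hh
  set D : ℝ := (h : ℝ) * ((m : ℝ) - 1) / (3 * (m : ℝ)) with hD
  have hD0 : 0 < D := div_pos (mul_pos (by linarith) (by linarith)) (by linarith)
  set A : ℝ := h * (Real.pi ^ 2 * (m - 1) / (12 * m)) with hA
  have hAD : A = Real.pi ^ 2 * D / 4 := by
    rw [hA, hD]
    field_simp
    ring
  have hA0 : 0 < A := by rw [hAD]; positivity
  -- Chosen so that `τ ^ 2 = √(A / n)` is the saddle point, that is `n = A / τ ^ 4`.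
  set τ : ℕ → ℝ := fun n => (A / n) ^ (1 / 4 : ℝ) with hτ
  have hτpos : ∀ n : ℕ, 0 < n → 0 < τ n := fun n hn => by
    have : (0 : ℝ) < n := by exact_mod_cast hn
    exact Real.rpow_pos_of_pos (div_pos hA0 this) _
  have hτlim : Tendsto τ atTop (𝓝[>] 0) := by
    refine tendsto_nhdsWithin_iff.2 ⟨?_, (eventually_gt_atTop 0).mono hτpos⟩
    have h1 := (tendsto_const_nhds (x := A)).div_atTop (tendsto_natCast_atTop_atTop (R := ℝ))
    have h2 := h1.rpow_const (p := (1 / 4 : ℝ)) (Or.inr (by norm_num))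
    rwa [Real.zero_rpow (by norm_num)] at h2
  have hint := (tendsto_integral_saddleIntegrand hm hh hA).comp hτlim
  have hs0 : 0 < √(Real.pi / A) := Real.sqrt_pos.2 (by positivity)
  rw [Asymptotics.isEquivalent_iff_exists_eq_mul]
  refine ⟨fun n => (∫ u, saddleIntegrand m h A (τ n) u).re / √(Real.pi / A), ?_, ?_⟩
  · have := hint.div_const √(Real.pi / A)
    rwa [div_self hs0.ne'] at this
  filter_upwards [eventually_gt_atTop 0] with n hn
  have hn0 : (0 : ℝ) < n := by exact_mod_cast hn
  have hAn : 0 < A / n := div_pos hA0 hn0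
  have hτn := hτpos n hn
  have hτ4 : τ n ^ 4 = A / n := by
    rw [hτ, ← Real.rpow_natCast, ← Real.rpow_mul hAn.le]
    norm_num
  have hτ2 : τ n ^ 2 = √(A / n) := by
    rw [← hτ4, show τ n ^ 4 = (τ n ^ 2) ^ 2 by ring, Real.sqrt_sq (by positivity)]
  have hτ3 : τ n ^ 3 = A ^ (3 / 4 : ℝ) / (n : ℝ) ^ (3 / 4 : ℝ) := by
    rw [hτ, ← Real.rpow_natCast, ← Real.rpow_mul hAn.le, ← Real.div_rpow hA0.le hn0.le]
    norm_num
  have hcoeff := coeff_qProductPow_eq_integral_saddleIntegrand (by omega : 0 < m) h n (A := A) hτn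
    (by rw [hτ4]; field_simp)
  have hexp : 2 * A / τ n ^ 2 =
      Real.pi * √((h : ℝ) * ((m : ℝ) - 1) * (n : ℝ) / (3 * (m : ℝ))) := by
    have e : (h : ℝ) * ((m : ℝ) - 1) * (n : ℝ) / (3 * (m : ℝ)) = (2 * A / τ n ^ 2 / Real.pi) ^ 2 := by
      rw [div_pow, div_pow, ← pow_mul, hτ4, hAD, mul_div_right_comm, ← hD]
      field_simp
      norm_num
    rw [e, Real.sqrt_sq (by positivity)]
    field_simp
  -- After cancelling powers, this is the fourth root of `4 A = π² D`.
  have hconst : A ^ (3 / 4 : ℝ) * √(Real.pi / A) * (2 : ℝ) ^ (3 / 2 : ℝ) =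
      D ^ (1 / 4 : ℝ) * (2 * Real.pi) := by
    have e1 : √(Real.pi / A) = Real.pi ^ (1 / 2 : ℝ) / A ^ (1 / 2 : ℝ) := by
      rw [Real.sqrt_eq_rpow, Real.div_rpow Real.pi_pos.le hA0.le]
    have e2 : A ^ (3 / 4 : ℝ) = A ^ (1 / 2 : ℝ) * A ^ (1 / 4 : ℝ) := by
      rw [← Real.rpow_add hA0]; norm_num
    have e3 : A ^ (1 / 4 : ℝ) * (2 : ℝ) ^ (1 / 2 : ℝ) = Real.pi ^ (1 / 2 : ℝ) * D ^ (1 / 4 : ℝ) := by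
      have h1 : (2 : ℝ) ^ (1 / 2 : ℝ) = 4 ^ (1 / 4 : ℝ) := by
        rw [show (4 : ℝ) = 2 ^ (2 : ℝ) by norm_num, ← Real.rpow_mul two_pos.le]
        norm_num
      have h2 : Real.pi ^ (1 / 2 : ℝ) = (Real.pi ^ 2) ^ (1 / 4 : ℝ) := by
        rw [← Real.rpow_natCast, ← Real.rpow_mul Real.pi_pos.le]
        norm_num
      rw [h1, h2, ← Real.mul_rpow hA0.le (by norm_num), ← Real.mul_rpow (by positivity) hD0.le, hAD]
      congr 1
      ring
    have e4 : (2 : ℝ) ^ (3 / 2 : ℝ) = 2 * 2 ^ (1 / 2 : ℝ) := by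
      rw [← Real.rpow_one_add' two_pos.le (by norm_num)]
      norm_num
    have e5 : Real.pi ^ (1 / 2 : ℝ) * Real.pi ^ (1 / 2 : ℝ) = Real.pi := by
      rw [← Real.rpow_add Real.pi_pos]
      norm_num
    have hne : A ^ (1 / 2 : ℝ) ≠ 0 := (Real.rpow_pos_of_pos hA0 _).ne'
    rw [e1, e2, e4]
    calc A ^ (1 / 2 : ℝ) * A ^ (1 / 4 : ℝ) * (Real.pi ^ (1 / 2 : ℝ) / A ^ (1 / 2 : ℝ)) *
          (2 * 2 ^ (1 / 2 : ℝ))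
        = 2 * Real.pi ^ (1 / 2 : ℝ) * (A ^ (1 / 4 : ℝ) * 2 ^ (1 / 2 : ℝ)) := by field_simp
      _ = D ^ (1 / 4 : ℝ) * (2 * (Real.pi ^ (1 / 2 : ℝ) * Real.pi ^ (1 / 2 : ℝ))) := by
        rw [e3]; ring
      _ = _ := by rw [e5]
  rw [hexp, hτ3] at hcoeff
  have hn34 : 0 < (n : ℝ) ^ (3 / 4 : ℝ) := Real.rpow_pos_of_pos hn0 _
  have h232 : 0 < (2 : ℝ) ^ (3 / 2 : ℝ) := Real.rpow_pos_of_pos two_pos _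
  rw [Pi.mul_apply]
  generalize (∫ u, saddleIntegrand m h A (τ n) u).re = J at hcoeff ⊢
  generalize Real.exp (Real.pi * √((h : ℝ) * ((m : ℝ) - 1) * (n : ℝ) / (3 * (m : ℝ)))) = E
    at hcoeff ⊢
  have h2pi : (2 * Real.pi : ℝ) ≠ 0 := by positivity
  apply mul_right_cancel₀ h2pi
  rw [hcoeff]
  have e6 : J / √(Real.pi / A) * (D ^ (1 / 4 : ℝ) * E / (2 ^ (3 / 2 : ℝ) * (n : ℝ) ^ (3 / 4 : ℝ))) *
      (2 * Real.pi) = D ^ (1 / 4 : ℝ) * (2 * Real.pi) * (J * E) /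
        (√(Real.pi / A) * 2 ^ (3 / 2 : ℝ) * (n : ℝ) ^ (3 / 4 : ℝ)) := by
    field_simp
  rw [e6, ← hconst]
  field_simp

theorem mainTheorem7 (m : ℕ) (hm : 1 < m) :
    (Multipliable (fun k : ℕ => qFactor m (k + 1)) ∧
      Asymptotics.IsEquivalent Filter.atTop
        (fun n : ℕ => PowerSeries.coeff n (qProduct m))
        (fun n : ℕ =>
          ((m : ℝ) - 1) ^ (1 / 4 : ℝ)
              * Real.exp (Real.pi * Real.sqrt (((m : ℝ) - 1) * (n : ℝ) / (3 * (m : ℝ))))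
            / ((2 : ℝ) ^ (3 / 2 : ℝ) * (3 : ℝ) ^ (1 / 4 : ℝ) * (m : ℝ) ^ (1 / 4 : ℝ)
                * (n : ℝ) ^ (3 / 4 : ℝ)))) ∧
    (∀ h : ℕ, 1 ≤ h →
      Multipliable (fun k : ℕ => qFactor m (k + 1) ^ h) ∧
      Asymptotics.IsEquivalent Filter.atTop
        (fun n : ℕ => PowerSeries.coeff n (qProductPow m h))
        (fun n : ℕ =>
          ((h : ℝ) * ((m : ℝ) - 1) / (3 * (m : ℝ))) ^ (1 / 4 : ℝ)
              * Real.exp (Real.pi *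
                  Real.sqrt ((h : ℝ) * ((m : ℝ) - 1) * (n : ℝ) / (3 * (m : ℝ))))
            / ((2 : ℝ) ^ (3 / 2 : ℝ) * (n : ℝ) ^ (3 / 4 : ℝ)))) := by
  have hm0 : 0 < m := by omega
  have hm1 : (0 : ℝ) ≤ (m : ℝ) - 1 := by
    have : (1 : ℝ) ≤ m := by exact_mod_cast hm.le
    linarith
  refine ⟨⟨by simpa using multipliable_qFactor_pow hm0 1, ?_⟩,
    fun h hh => ⟨multipliable_qFactor_pow hm0 h, isEquivalent_coeff_qProductPow hm hh⟩⟩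
  have h1 := isEquivalent_coeff_qProductPow hm le_rfl
  have hq : qProductPow m 1 = qProduct m := by simp [qProductPow, qProduct]
  rw [hq] at h1
  convert! h1 using 2 with n
  rw [Nat.cast_one, one_mul, Real.div_rpow hm1 (by positivity),
    Real.mul_rpow (by norm_num) (Nat.cast_nonneg m)]
  rw [div_mul_eq_mul_div, div_div]
  congr 1
  ring
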